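/- Let $M=\mathbb R^2_{x,y}\times S^1_\theta$, $q_0=(0,0,0)$, and let $N=T^*_{q_0}M\cong\mathbb R^3$ be the domain of the exponential mapping of Euler's elastic problem ($\dot x=\cos\theta$, $\dot y=\sin\theta$, $\dot\theta=u$, $\frac12\int_0^1u^2\,dt\to\min$). For $\lambda\in N$ put $h_i(\lambda)=\langle\lambda,X_i(q_0)\rangle$, where $X_1=\cos\theta\,\partial_x+\sin\theta\,\partial_y$, $X_2=\partial_\theta$, $X_3=[X_1,X_2]=\sin\theta\,\partial_x-\cos\theta\,\partial_y$, and define $(\beta,c,r)$, $r\ge 0$, $\beta\in\mathbb R/2\pi\mathbb Z$, by $h_1=-r\cos\beta$, $h_3=-r\sin\beta$, $h_2=c$. Let $E=\frac{c^2}{2}-r\cos\beta$ and $$N_1=\{r\ne0,\ -r<E<r\},\quad N_2=\{r\neq 0,\ E>r\},\quad N_3=\{r\ne0,\ E=r,\ \beta\ne\pi\},\quad N_i^\pm=N_i\cap\{\operatorname{sgn}c=\pm1\}\ (i=2,3).$$ Let $K(k)$ be the complete elliptic integral of the first kind and $\operatorname{sn},\operatorname{cn},\operatorname{dn}$ Jacobi's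 elliptic functions of modulus $k$. Coordinates $(\varphi,k,r)$ are introduced by $$\lambda\in N_1:\quad \sin\tfrac\beta2=k\operatorname{sn}(\sqrt r\varphi,k),\ \ \cos\tfrac\beta2=\operatorname{dn}(\sqrt r\varphi,k),\ \ \tfrac c2=k\sqrt r\operatorname{cn}(\sqrt r\varphi,k),\quad k\in(0,1),\ \varphi\in\mathbb R/\tfrac{4K}{\sqrt r}\mathbb Z;$$ $$\lambda\in N_2^\pm:\quad \sin\tfrac\beta2=\pm\operatorname{sn}\big(\tfrac{\sqrt r\varphi}{k},k\big),\ \ \cos\tfrac\beta2=\operatorname{cn}\big(\tfrac{\sqrt r\varphi}{k},k\big),\ \ \tfrac c2=\pm\tfrac{\sqrt r}{k}\operatorname{dn}\big(\tfrac{\sqrt r\varphi}{k},k\big),\quad k\in(0,1),\ \varphi\in\mathbb R/\tfrac{2kK}{\sqrt r}\mathbb Z;$$ $$\lambda\in N_3^\pm:\quad \sin\tfrac\beta2=\pm\tanh(\sqrt r\varphi),\ \ \cos\tfrac\beta2=\frac1{\cosh(\sqrt r\varphi)},\ \ \tfrac c2=\pm\frac{\sqrt r}{\cosh(\sqrt r\varphi)},\quad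 k=1,\ \varphi\in\mathbb R$$ (for a suitable representative of $\beta$ modulo $2\pi$). Put $p=\frac{\sqrt r}{2}$, $\tau=\sqrt r(\varphi+\frac12)$ on $N_1\cup N_3$, and $p=\frac{\sqrt r}{2k}$, $\tau=\frac{\sqrt r}{k}(\varphi+\frac12)$ on $N_2$; thus $\tau$ is defined modulo $4K$ on $N_1$ and modulo $2K$ on $N_2$. For $k\in(0,1)$ let $p_1^1(k)$ be the first positive root $p$ of $$f_1(p,k)=\operatorname{sn}p\,\operatorname{dn}p-\Big(2\int_0^p\operatorname{dn}^2t\,dt-p\Big)\operatorname{cn}p=0$$ and $p_1(k)=\min(2K(k),p_1^1(k))$. Define $L_1,\dots,L_4\subset N$ as follows: $L_j$ is the union of - the points of $N_1$ with $k\in(0,1)$, $p\in(0,p_1(k))$ and $\tau\in((j-1)K,jK)$; - the points with $k\in(0,1)$, $p\in(0,K(k))$ lying in $N_2^+$ with $\tau\in(0,K)$ for $j=1$; in $N_2^-$ with $\tau\in(-K,0)$ for $j=2$; in $N_2^-$ with $\tau\in(0,K)$ for $j=3$; in $N_2^+$ with $\tau\in(-K,0)$ for $j=4$; - the points with $p\in(0,+\infty)$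 lying in $N_3^+$ with $\tau>0$ for $j=1$; in $N_3^-$ with $\tau<0$ for $j=2$; in $N_3^-$ with $\tau>0$ for $j=3$; in $N_3^+$ with $\tau<0$ for $j=4$. Then each of the sets $L_1,L_2,L_3,L_4$ is open in $N$ and arcwise connected. -/

import Mathlib

namespace Elastica

noncomputable section

/-! ### Jacobi elliptic functions of modulus `k ∈ (0, 1)` -/

/-- The elliptic integral of the first kind `F(u, k)`. -/
def ellF (u k : ℝ) : ℝ := ∫ t in (0 : ℝ)..u, 1 / √(1 - k ^ 2 * Real.sin t ^ 2)

/-- The complete elliptic integral of the first kind `K(k)`. -/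
def ellK (k : ℝ) : ℝ := ellF (Real.pi / 2) k

/-- Jacobi's amplitude `am(·, k)`: the inverse of the increasing bijection `F(·, k) : ℝ → ℝ`,
for `k ∈ (0, 1)`. -/
def am (p k : ℝ) : ℝ := Function.invFun (fun u => ellF u k) p

def sn (p k : ℝ) : ℝ := Real.sin (am p k)

def cn (p k : ℝ) : ℝ := Real.cos (am p k)

def dn (p k : ℝ) : ℝ := √(1 - k ^ 2 * sn p k ^ 2)

/-- Jacobi's epsilon function `E(p) = ∫₀ᵖ dn² t dt`. -/
def jacobiEpsilon (p k : ℝ) : ℝ := ∫ t in (0 : ℝ)..p, dn t k ^ 2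

def f₁ (p k : ℝ) : ℝ := sn p k * dn p k - (2 * jacobiEpsilon p k - p) * cn p k

/-- The first positive root of `f₁(·, k)`; it lies in `(K, 3K)`. -/
def p₁₁ (k : ℝ) : ℝ := sInf {p : ℝ | 0 < p ∧ f₁ p k = 0}

def p₁ (k : ℝ) : ℝ := min (2 * ellK k) (p₁₁ k)

/-! ### The preimage of the exponential mapping -/

/-- Tangent vectors of `M = ℝ² × S¹` in the coordinate frame `∂/∂x, ∂/∂y, ∂/∂θ`. -/
abbrev TangentM : Type := ℝ × ℝ × ℝ

/-- The preimage `N = T*_{q₀} M` of the exponential mapping, `q₀ = (0, 0, 0)`, with its usual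
topology of a finite-dimensional vector space. -/
abbrev N : Type := TangentM →L[ℝ] ℝ

/-- The vector field `X₁ = cos θ ∂/∂x + sin θ ∂/∂y` at `(x, y, θ)`. -/
def X₁ (θ : ℝ) : TangentM := (Real.cos θ, Real.sin θ, 0)

/-- The vector field `X₂ = ∂/∂θ`. -/
def X₂ (_θ : ℝ) : TangentM := (0, 0, 1)

/-- The vector field `X₃ = [X₁, X₂] = sin θ ∂/∂x - cos θ ∂/∂y` at `(x, y, θ)`. -/
def X₃ (θ : ℝ) : TangentM := (Real.sin θ, -Real.cos θ, 0)

def h₁ (lam : N) : ℝ := lam (X₁ 0)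

def h₂ (lam : N) : ℝ := lam (X₂ 0)

def h₃ (lam : N) : ℝ := lam (X₃ 0)

/-! The coordinates `(β, c, r)`: `h₁ = -r cos β`, `h₃ = -r sin β`, `h₂ = c`. -/

def rad (lam : N) : ℝ := √(h₁ lam ^ 2 + h₃ lam ^ 2)

/-- The angle `β` modulo `2π` (meaningful for `r ≠ 0`). -/
def beta (lam : N) : Real.Angle := (Complex.arg ⟨-h₁ lam, -h₃ lam⟩ : ℝ)

def vel (lam : N) : ℝ := h₂ lam

/-- The pendulum energy `E = c² / 2 - r cos β`. -/
def energy (lam : N) : ℝ := vel lam ^ 2 / 2 - rad lam * (beta lam).cos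

theorem h₁_eq (lam : N) : h₁ lam = -(rad lam * (beta lam).cos) := by
  have h := Complex.norm_mul_cos_arg ⟨-h₁ lam, -h₃ lam⟩
  have hn : ‖(⟨-h₁ lam, -h₃ lam⟩ : ℂ)‖ = rad lam := by
    rw [Complex.norm_def, Complex.normSq_apply, rad]; congr 1; ring
  rw [hn] at h
  simp only [beta, Real.Angle.cos_coe]
  linarith

theorem h₃_eq (lam : N) : h₃ lam = -(rad lam * (beta lam).sin) := by
  have h := Complex.norm_mul_sin_arg ⟨-h₁ lam, -h₃ lam⟩
  have hn : ‖(⟨-h₁ lam, -h₃ lam⟩ : ℂ)‖ = rad lam := by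
    rw [Complex.norm_def, Complex.normSq_apply, rad]; congr 1; ring
  rw [hn] at h
  simp only [beta, Real.Angle.sin_coe]
  linarith

def N₁ : Set N := {lam | rad lam ≠ 0 ∧ -rad lam < energy lam ∧ energy lam < rad lam}

def N₂ : Set N := {lam | rad lam ≠ 0 ∧ rad lam < energy lam}

def N₃ : Set N := {lam | rad lam ≠ 0 ∧ energy lam = rad lam ∧ beta lam ≠ (Real.pi : Real.Angle)}

/-- `N₂^±`, for the sign `s = ±1` of `c`. -/
def N₂s (s : SignType) : Set N := {lam | lam ∈ N₂ ∧ SignType.sign (vel lam) = s}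

/-- `N₃^±`, for the sign `s = ±1` of `c`. -/
def N₃s (s : SignType) : Set N := {lam | lam ∈ N₃ ∧ SignType.sign (vel lam) = s}

/-! ### Elliptic coordinates `(φ, k, r)` and the coordinates `(τ, p, k)`

The coordinates `φ` and `τ` are periodic (on `N₁` and `N₂`), so coordinates are given as relations:
a point is related to every representative of its coordinates. The real number `b` below is a
representative of the angle `β`. -/

/-- `(φ, k, r)` are elliptic coordinates of `lam ∈ N₁`. -/
def IsElliptic₁ (lam : N) (φ k r : ℝ) : Prop :=
  lam ∈ N₁ ∧ r = rad lam ∧ 0 < k ∧ k < 1 ∧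
    ∃ b : ℝ, (b : Real.Angle) = beta lam ∧
      Real.sin (b / 2) = k * sn (√r * φ) k ∧
      Real.cos (b / 2) = dn (√r * φ) k ∧
      vel lam / 2 = k * √r * cn (√r * φ) k

/-- `(φ, k, r)` are elliptic coordinates of `lam ∈ N₂^±`. -/
def IsElliptic₂ (s : SignType) (lam : N) (φ k r : ℝ) : Prop :=
  lam ∈ N₂s s ∧ r = rad lam ∧ 0 < k ∧ k < 1 ∧
    ∃ b : ℝ, (b : Real.Angle) = beta lam ∧
      Real.sin (b / 2) = (s : ℝ) * sn (√r * φ / k) k ∧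
      Real.cos (b / 2) = cn (√r * φ / k) k ∧
      vel lam / 2 = (s : ℝ) * (√r / k) * dn (√r * φ / k) k

/-- `(φ, 1, r)` are elliptic coordinates of `lam ∈ N₃^±`; for the modulus `k = 1` one has
`sn = tanh` and `cn = dn = 1 / cosh`. -/
def IsElliptic₃ (s : SignType) (lam : N) (φ r : ℝ) : Prop :=
  lam ∈ N₃s s ∧ r = rad lam ∧
    ∃ b : ℝ, (b : Real.Angle) = beta lam ∧
      Real.sin (b / 2) = (s : ℝ) * Real.tanh (√r * φ) ∧
      Real.cos (b / 2) = 1 / Real.cosh (√r * φ) ∧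
      vel lam / 2 = (s : ℝ) * √r * (1 / Real.cosh (√r * φ))

/-- `(τ, p, k)` are coordinates of `lam ∈ N₁`. -/
def HasCoords₁ (lam : N) (τ p k : ℝ) : Prop :=
  ∃ φ r : ℝ, IsElliptic₁ lam φ k r ∧ p = √r / 2 ∧ τ = √r * (φ + 1 / 2)

/-- `(τ, p, k)` are coordinates of `lam ∈ N₂^±`. -/
def HasCoords₂ (s : SignType) (lam : N) (τ p k : ℝ) : Prop :=
  ∃ φ r : ℝ, IsElliptic₂ s lam φ k r ∧ p = √r / (2 * k) ∧ τ = √r / k * (φ + 1 / 2)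

/-- `(τ, p, 1)` are coordinates of `lam ∈ N₃^±`. -/
def HasCoords₃ (s : SignType) (lam : N) (τ p : ℝ) : Prop :=
  ∃ φ r : ℝ, IsElliptic₃ s lam φ r ∧ p = √r / 2 ∧ τ = √r * (φ + 1 / 2)

/-! ### The domains `L₁, …, L₄` -/

/-- The points of `N₁` with `τ ∈ (a K, b K)`, `p ∈ (0, p₁)`, `k ∈ (0, 1)`. -/
def block₁ (a b : ℝ) : Set N :=
  {lam | ∃ τ p k : ℝ, HasCoords₁ lam τ p k ∧ τ ∈ Set.Ioo (a * ellK k) (b * ellK k) ∧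
    p ∈ Set.Ioo 0 (p₁ k) ∧ k ∈ Set.Ioo (0 : ℝ) 1}

/-- The points of `N₂^±` with `τ ∈ (a K, b K)`, `p ∈ (0, K)`, `k ∈ (0, 1)`. -/
def block₂ (s : SignType) (a b : ℝ) : Set N :=
  {lam | ∃ τ p k : ℝ, HasCoords₂ s lam τ p k ∧ τ ∈ Set.Ioo (a * ellK k) (b * ellK k) ∧
    p ∈ Set.Ioo 0 (ellK k) ∧ k ∈ Set.Ioo (0 : ℝ) 1}

/-- The points of `N₃^±` with `τ ∈ I`, `p ∈ (0, +∞)`. -/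
def block₃ (s : SignType) (I : Set ℝ) : Set N :=
  {lam | ∃ τ p : ℝ, HasCoords₃ s lam τ p ∧ τ ∈ I ∧ p ∈ Set.Ioi (0 : ℝ)}

def L₁ : Set N := block₁ 0 1 ∪ block₂ 1 0 1 ∪ block₃ 1 (Set.Ioi 0)

def L₂ : Set N := block₁ 1 2 ∪ block₂ (-1) (-1) 0 ∪ block₃ (-1) (Set.Iio 0)

def L₃ : Set N := block₁ 2 3 ∪ block₂ (-1) 0 1 ∪ block₃ (-1) (Set.Ioi 0)

def L₄ : Set N := block₁ 3 4 ∪ block₂ 1 (-1) 0 ∪ block₃ 1 (Set.Iio 0)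

end

end Elastica

namespace Elastica

open Set Filter Topology

/-! ### Jacobi elliptic functions -/

/-! The covector evolves by the pendulum equation, whose phase in the elliptic coordinates moves at
constant speed `2p`. Since `τ` is the initial phase plus `p`, it is the phase at time `1/2`, the
midpoint of the elastica. The time-`1/2` flow is a homeomorphism of `N ≅ ℝ³`, so each `L_j` may be
studied through its midpoint states.

At the midpoint the conditions become simple. The restriction of `τ` to a quarter period is a choice
of signs of `h₃` and `h₂`: `(-,+)`, `(-,-)`, `(+,-)`, `(+,+)` for `L₁`, …, `L₄`, uniformly over
oscillation, rotation and separatrix. The bound on `p` involves only the first integrals `r` and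
`E`; this is `Admissible`. Hence each `L_j` is the preimage of some `region ε δ`
(`union_eq_preimage_region`), and two facts about regions remain.

Openness (`isOpen_region`): off the separatrix it follows from lower semicontinuity of `p₁` and
continuity of `K`. On the separatrix it holds because `K(k) → ∞` as `k → 1` and `K ≤ p₁`, so the
bounds on both sides recede to infinity.

Path-connectedness (`isPathConnected_region`): the dilation `r ↦ s²r`, `c ↦ sc` keeps the modulus
and multiplies `p` by `s`. It therefore contracts a region, within itself, into the unit ball, where
only the sign conditions matter and they cut out a convex set. -/

theorem radicand_pos {k : ℝ} (hk : k ∈ Ioo (0 : ℝ) 1) (t : ℝ) :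
    0 < 1 - k ^ 2 * Real.sin t ^ 2 := by
  have h1 : k ^ 2 < 1 := by nlinarith [hk.1, hk.2]
  nlinarith [Real.sin_sq_le_one t, sq_nonneg (Real.sin t), sq_nonneg k]

theorem continuous_ellF_integrand :
    Continuous fun q : Ioo (0 : ℝ) 1 × ℝ => 1 / √(1 - (q.1 : ℝ) ^ 2 * Real.sin q.2 ^ 2) := by
  refine continuous_const.div (by fun_prop) fun q => ?_
  exact (Real.sqrt_pos.2 (radicand_pos q.1.2 q.2)).ne'

theorem hasDerivAt_ellF {k : ℝ} (hk : k ∈ Ioo (0 : ℝ) 1) (u : ℝ) :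
    HasDerivAt (fun u => ellF u k) (1 / √(1 - k ^ 2 * Real.sin u ^ 2)) u := by
  have hc : Continuous fun t : ℝ => 1 / √(1 - k ^ 2 * Real.sin t ^ 2) :=
    continuous_ellF_integrand.comp
      (by fun_prop : Continuous fun t : ℝ => ((⟨k, hk⟩ : Ioo (0 : ℝ) 1), t))
  exact intervalIntegral.integral_hasDerivAt_right (hc.intervalIntegrable _ _)
    (hc.stronglyMeasurableAtFilter _ _) hc.continuousAt

theorem ellF_integrand_ge_one {k : ℝ} (hk : k ∈ Ioo (0 : ℝ) 1) (u : ℝ) :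
    1 ≤ 1 / √(1 - k ^ 2 * Real.sin u ^ 2) := by
  rw [le_div_iff₀ (Real.sqrt_pos.2 (radicand_pos hk u)), one_mul]
  exact Real.sqrt_le_one.2 (by nlinarith [mul_nonneg (sq_nonneg k) (sq_nonneg (Real.sin u))])

@[simp] theorem ellF_zero (k : ℝ) : ellF 0 k = 0 := by simp [ellF]

theorem strictMono_ellF {k : ℝ} (hk : k ∈ Ioo (0 : ℝ) 1) : StrictMono fun u => ellF u k := by
  refine strictMono_of_deriv_pos fun u => ?_
  rw [(hasDerivAt_ellF hk u).deriv]
  exact one_pos.trans_le (ellF_integrand_ge_one hk u)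

/-- The integrand is at least `1`. The resulting comparison with the identity gives both
surjectivity of `F(·, k)` and `K ≥ π/2`. -/
theorem monotone_ellF_sub_id {k : ℝ} (hk : k ∈ Ioo (0 : ℝ) 1) :
    Monotone fun u => ellF u k - u := by
  have h := fun u => (hasDerivAt_ellF hk u).sub (hasDerivAt_id u)
  refine monotone_of_deriv_nonneg (fun u => (h u).differentiableAt) fun u => ?_
  refine (h u).deriv.symm ▸ sub_nonneg.2 (ellF_integrand_ge_one hk u)

theorem le_ellF {k : ℝ} (hk : k ∈ Ioo (0 : ℝ) 1) {u : ℝ} (hu : 0 ≤ u) : u ≤ ellF u k := by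
  simpa using monotone_ellF_sub_id hk hu

theorem ellF_le {k : ℝ} (hk : k ∈ Ioo (0 : ℝ) 1) {u : ℝ} (hu : u ≤ 0) : ellF u k ≤ u := by
  simpa using monotone_ellF_sub_id hk hu

theorem continuous_ellF {k : ℝ} (hk : k ∈ Ioo (0 : ℝ) 1) : Continuous fun u => ellF u k :=
  continuous_iff_continuousAt.2 fun u => (hasDerivAt_ellF hk u).continuousAt

theorem surjective_ellF {k : ℝ} (hk : k ∈ Ioo (0 : ℝ) 1) :
    Function.Surjective fun u => ellF u k := by
  refine (continuous_ellF hk).surjective ?_ ?_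
  · refine tendsto_atTop_mono' _ ?_ tendsto_id
    filter_upwards [eventually_ge_atTop 0] with u hu using le_ellF hk hu
  · refine tendsto_atBot_mono' _ ?_ tendsto_id
    filter_upwards [eventually_le_atBot 0] with u hu using ellF_le hk hu

theorem ellF_am {k : ℝ} (hk : k ∈ Ioo (0 : ℝ) 1) (p : ℝ) : ellF (am p k) k = p :=
  Function.rightInverse_invFun (surjective_ellF hk) p

theorem am_ellF {k : ℝ} (hk : k ∈ Ioo (0 : ℝ) 1) (u : ℝ) : am (ellF u k) k = u :=
  Function.leftInverse_invFun (strictMono_ellF hk).injective u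

theorem lt_am_iff {k : ℝ} (hk : k ∈ Ioo (0 : ℝ) 1) {p u : ℝ} : u < am p k ↔ ellF u k < p := by
  rw [← (strictMono_ellF hk).lt_iff_lt, ellF_am hk]

theorem am_lt_iff {k : ℝ} (hk : k ∈ Ioo (0 : ℝ) 1) {p u : ℝ} : am p k < u ↔ p < ellF u k := by
  rw [← (strictMono_ellF hk).lt_iff_lt, ellF_am hk]

theorem ellF_neg {k : ℝ} (hk : k ∈ Ioo (0 : ℝ) 1) (u : ℝ) : ellF (-u) k = -ellF u k := by
  have h : ∀ x, HasDerivAt (fun u => ellF (-u) k + ellF u k) 0 x := fun x => by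
    have := ((hasDerivAt_ellF hk (-x)).comp x (hasDerivAt_neg x)).add (hasDerivAt_ellF hk x)
    exact this.congr_deriv (by simp)
  have := is_const_of_deriv_eq_zero (fun x => (h x).differentiableAt) (fun x => (h x).deriv) u 0
  simp only [neg_zero, ellF_zero, add_zero] at this
  linarith

/-- By `sin (π - t) = sin t` the sum of the two integrals has zero derivative, and it is evaluated
at `π/2`. With oddness this yields `F` at all the multiples of `π/2` needed for quarter periods. -/
theorem ellF_pi_sub {k : ℝ} (hk : k ∈ Ioo (0 : ℝ) 1) (u : ℝ) :
    ellF (Real.pi - u) k = 2 * ellK k - ellF u k := by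
  have h : ∀ x, HasDerivAt (fun u => ellF (Real.pi - u) k + ellF u k) 0 x := fun x => by
    have := ((hasDerivAt_ellF hk (Real.pi - x)).comp x ((hasDerivAt_id x).const_sub Real.pi)).add
      (hasDerivAt_ellF hk x)
    exact this.congr_deriv (by simp)
  have := is_const_of_deriv_eq_zero (fun x => (h x).differentiableAt) (fun x => (h x).deriv) u
    (Real.pi / 2)
  simp only [show Real.pi - Real.pi / 2 = Real.pi / 2 by ring] at this
  rw [ellK]
  linarith

theorem ellF_pi {k : ℝ} (hk : k ∈ Ioo (0 : ℝ) 1) : ellF Real.pi k = 2 * ellK k := by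
  simpa using ellF_pi_sub hk 0

theorem ellF_three_pi_div_two {k : ℝ} (hk : k ∈ Ioo (0 : ℝ) 1) :
    ellF (3 * Real.pi / 2) k = 3 * ellK k := by
  have := ellF_pi_sub hk (-(Real.pi / 2))
  rw [ellF_neg hk] at this
  rw [show 3 * Real.pi / 2 = Real.pi - -(Real.pi / 2) by ring, this, ellK]
  ring

theorem ellF_two_pi {k : ℝ} (hk : k ∈ Ioo (0 : ℝ) 1) : ellF (2 * Real.pi) k = 4 * ellK k := by
  have := ellF_pi_sub hk (-Real.pi)
  rw [ellF_neg hk, ellF_pi hk] at this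
  rw [show 2 * Real.pi = Real.pi - -Real.pi by ring, this]
  ring

theorem pi_div_two_le_ellK {k : ℝ} (hk : k ∈ Ioo (0 : ℝ) 1) : Real.pi / 2 ≤ ellK k :=
  le_ellF hk (by positivity)

theorem ellK_pos {k : ℝ} (hk : k ∈ Ioo (0 : ℝ) 1) : 0 < ellK k :=
  Real.pi_div_two_pos.trans_le (pi_div_two_le_ellK hk)

theorem dn_pos {k : ℝ} (hk : k ∈ Ioo (0 : ℝ) 1) (p : ℝ) : 0 < dn p k :=
  Real.sqrt_pos.2 (radicand_pos hk _)

theorem dn_sq {k : ℝ} (hk : k ∈ Ioo (0 : ℝ) 1) (p : ℝ) : dn p k ^ 2 = 1 - k ^ 2 * sn p k ^ 2 :=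
  Real.sq_sqrt (radicand_pos hk _).le

theorem sn_sq_add_cn_sq (p k : ℝ) : sn p k ^ 2 + cn p k ^ 2 = 1 := Real.sin_sq_add_cos_sq _

theorem continuous_ellF_prod : Continuous fun q : Ioo (0 : ℝ) 1 × ℝ => ellF q.2 q.1 :=
  intervalIntegral.continuous_parametric_primitive_of_continuous
    (f := fun (k : Ioo (0 : ℝ) 1) t => 1 / √(1 - (k : ℝ) ^ 2 * Real.sin t ^ 2))
    continuous_ellF_integrand

theorem continuous_ellK : Continuous fun k : Ioo (0 : ℝ) 1 => ellK k :=
  continuous_ellF_prod.comp (by fun_prop : Continuous fun k : Ioo (0 : ℝ) 1 => (k, Real.pi / 2))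

/-- Joint continuity of the inverse is checked in the order topology: `u < am p k` means `F(u, k) <
p`, an open condition because `F` is continuous in `k`. -/
theorem continuous_am : Continuous fun q : Ioo (0 : ℝ) 1 × ℝ => am q.2 q.1 := by
  refine continuous_iff_continuousAt.2 fun q => ?_
  have hF : ∀ u, Continuous fun q : Ioo (0 : ℝ) 1 × ℝ => ellF u q.1 := fun u =>
    continuous_ellF_prod.comp (by fun_prop : Continuous fun q : Ioo (0 : ℝ) 1 × ℝ => (q.1, u))
  refine tendsto_order.2 ⟨fun u hu => ?_, fun u hu => ?_⟩
  · rw [lt_am_iff q.1.2] at hu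
    filter_upwards [(hF u).continuousAt.eventually_lt continuous_snd.continuousAt hu] with q' h
    exact (lt_am_iff q'.1.2).2 h
  · have hu := (am_lt_iff q.1.2).1 hu
    filter_upwards [continuous_snd.continuousAt.eventually_lt (hF u).continuousAt hu] with q' h
    exact (am_lt_iff q'.1.2).2 h

theorem continuous_sn : Continuous fun q : Ioo (0 : ℝ) 1 × ℝ => sn q.2 q.1 :=
  Real.continuous_sin.comp continuous_am

theorem continuous_cn : Continuous fun q : Ioo (0 : ℝ) 1 × ℝ => cn q.2 q.1 :=
  Real.continuous_cos.comp continuous_am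

theorem continuous_dn : Continuous fun q : Ioo (0 : ℝ) 1 × ℝ => dn q.2 q.1 := by
  have := continuous_sn
  unfold dn
  fun_prop

theorem continuous_jacobiEpsilon :
    Continuous fun q : Ioo (0 : ℝ) 1 × ℝ => jacobiEpsilon q.2 q.1 :=
  intervalIntegral.continuous_parametric_primitive_of_continuous
    (f := fun (k : Ioo (0 : ℝ) 1) t => dn t k ^ 2) (continuous_dn.pow 2)

theorem hasDerivAt_am {k : ℝ} (hk : k ∈ Ioo (0 : ℝ) 1) (p : ℝ) :
    HasDerivAt (fun p => am p k) (dn p k) p := by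
  have hc : Continuous fun p => am p k :=
    continuous_am.comp (by fun_prop : Continuous fun t : ℝ => ((⟨k, hk⟩ : Ioo (0 : ℝ) 1), t))
  have := HasDerivAt.of_local_left_inverse hc.continuousAt (hasDerivAt_ellF hk (am p k))
    (one_pos.trans_le (ellF_integrand_ge_one hk _)).ne' (Eventually.of_forall (ellF_am hk))
  simpa [dn, sn] using this

theorem hasDerivAt_sn {k : ℝ} (hk : k ∈ Ioo (0 : ℝ) 1) (p : ℝ) :
    HasDerivAt (fun p => sn p k) (cn p k * dn p k) p :=
  (Real.hasDerivAt_sin _).comp p (hasDerivAt_am hk p)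

theorem hasDerivAt_cn {k : ℝ} (hk : k ∈ Ioo (0 : ℝ) 1) (p : ℝ) :
    HasDerivAt (fun p => cn p k) (-sn p k * dn p k) p :=
  (Real.hasDerivAt_cos _).comp p (hasDerivAt_am hk p)

theorem hasDerivAt_dn {k : ℝ} (hk : k ∈ Ioo (0 : ℝ) 1) (p : ℝ) :
    HasDerivAt (fun p => dn p k) (-k ^ 2 * sn p k * cn p k) p := by
  have h := ((((hasDerivAt_sn hk p).pow 2).const_mul (k ^ 2)).const_sub 1).sqrt
    (radicand_pos hk (am p k)).ne'
  have hd := dn_pos hk p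
  refine h.congr_deriv ?_
  change _ / (2 * dn p k) = _
  field_simp
  push_cast
  ring

theorem hasDerivAt_jacobiEpsilon {k : ℝ} (hk : k ∈ Ioo (0 : ℝ) 1) (p : ℝ) :
    HasDerivAt (fun p => jacobiEpsilon p k) (dn p k ^ 2) p := by
  have hc : Continuous fun t : ℝ => dn t k ^ 2 := (continuous_dn.pow 2).comp
    (by fun_prop : Continuous fun t : ℝ => ((⟨k, hk⟩ : Ioo (0 : ℝ) 1), t))
  exact intervalIntegral.integral_hasDerivAt_right (hc.intervalIntegrable _ _)
    (hc.stronglyMeasurableAtFilter _ _) hc.continuousAt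

/-- `K(k)` grows at least logarithmically in the complementary modulus as `k → 1`. -/
theorem log_le_ellK {k : ℝ} (hk : k ∈ Ioo (0 : ℝ) 1) :
    Real.log (1 / √(1 - k ^ 2)) ≤ ellK k := by
  set d := √(1 - k ^ 2) with hd
  have hk2 : 0 < 1 - k ^ 2 := by nlinarith [hk.1, hk.2]
  have hd0 : 0 < d := Real.sqrt_pos.2 hk2
  have hdsq : d ^ 2 = 1 - k ^ 2 := Real.sq_sqrt hk2.le
  -- The integrand dominates `1 / (π/2 - u + d)`: indeed `1 - k² sin² u = cos² u + d² sin² u`, and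
  -- `cos u ≤ π/2 - u`. Integrating the lower bound produces the logarithm.
  have hderiv : ∀ u ∈ Icc (0 : ℝ) (Real.pi / 2),
      HasDerivAt (fun u => ellF u k + Real.log (Real.pi / 2 - u + d))
        (1 / √(1 - k ^ 2 * Real.sin u ^ 2) - 1 / (Real.pi / 2 - u + d)) u := fun u hu => by
    have h := (hasDerivAt_ellF hk u).add
      ((((hasDerivAt_id u).const_sub (Real.pi / 2)).add_const d).log
        (by simp only [id]; linarith [hu.2]))
    exact h.congr_deriv (by simp only [id]; ring)
  have hmono : MonotoneOn (fun u => ellF u k + Real.log (Real.pi / 2 - u + d))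
      (Icc 0 (Real.pi / 2)) := by
    refine monotoneOn_of_deriv_nonneg (convex_Icc _ _)
      (fun u hu => (hderiv u hu).continuousAt.continuousWithinAt)
      (fun u hu => (hderiv u (interior_subset hu)).differentiableAt.differentiableWithinAt)
      fun u hu => ?_
    have hu' := interior_subset hu
    rw [(hderiv u hu').deriv, sub_nonneg]
    have hs : 0 ≤ Real.pi / 2 - u := by linarith [hu'.2]
    refine one_div_le_one_div_of_le (Real.sqrt_pos.2 (radicand_pos hk u)) ?_
    refine Real.sqrt_le_iff.2 ⟨by linarith, ?_⟩
    have h1 : Real.cos u ≤ Real.pi / 2 - u := by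
      rw [← Real.sin_pi_div_two_sub]; exact Real.sin_le hs
    have h2 : 0 ≤ Real.cos u := Real.cos_nonneg_of_neg_pi_div_two_le_of_le
      (by linarith [hu'.1, Real.pi_pos]) hu'.2
    nlinarith [Real.sin_sq_add_cos_sq u, mul_nonneg hs hd0.le, sq_nonneg (Real.cos u),
      mul_nonneg (sq_nonneg d) (sq_nonneg (Real.cos u))]
  have h := hmono (left_mem_Icc.2 Real.pi_div_two_pos.le) (right_mem_Icc.2 Real.pi_div_two_pos.le)
    Real.pi_div_two_pos.le
  simp only [ellF_zero, sub_zero, sub_self, zero_add] at h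
  have h3 : 0 ≤ Real.log (Real.pi / 2 + d) := Real.log_nonneg (by linarith [Real.pi_gt_three])
  rw [one_div, Real.log_inv, ellK]
  linarith

theorem tendsto_ellK_one : Tendsto ellK (𝓝[<] 1) atTop := by
  have h1 : Tendsto (fun k : ℝ => √(1 - k ^ 2)) (𝓝[<] 1) (𝓝[>] 0) := by
    refine tendsto_nhdsWithin_iff.2 ⟨?_, ?_⟩
    · have : Continuous fun k : ℝ => √(1 - k ^ 2) := by fun_prop
      simpa using (this.tendsto 1).mono_left nhdsWithin_le_nhds
    · filter_upwards [Ioo_mem_nhdsLT (zero_lt_one (α := ℝ))] with k hk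
      exact Real.sqrt_pos.2 (by nlinarith [hk.1, hk.2])
  have h2 := Real.tendsto_log_atTop.comp (tendsto_inv_nhdsGT_zero.comp h1)
  refine tendsto_atTop_mono' _ ?_ h2
  filter_upwards [Ioo_mem_nhdsLT (zero_lt_one (α := ℝ))] with k hk
  simpa using log_le_ellK hk

/-! ### The first positive root of `f₁` -/

theorem am_ellK {k : ℝ} (hk : k ∈ Ioo (0 : ℝ) 1) : am (ellK k) k = Real.pi / 2 := am_ellF hk _

theorem am_zero {k : ℝ} (hk : k ∈ Ioo (0 : ℝ) 1) : am 0 k = 0 := by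
  simpa using am_ellF hk 0

theorem hasDerivAt_f₁ {k : ℝ} (hk : k ∈ Ioo (0 : ℝ) 1) (p : ℝ) :
    HasDerivAt (fun p => f₁ p k) ((2 * jacobiEpsilon p k - p) * sn p k * dn p k) p := by
  have h := ((hasDerivAt_sn hk p).mul (hasDerivAt_dn hk p)).sub
    ((((hasDerivAt_jacobiEpsilon hk p).const_mul 2).sub (hasDerivAt_id p)).mul
      (hasDerivAt_cn hk p))
  refine h.congr_deriv ?_
  have hd := dn_sq hk p
  simp only [id, Pi.sub_apply]
  linear_combination (-cn p k) * hd

theorem continuous_f₁ : Continuous fun q : Ioo (0 : ℝ) 1 × ℝ => f₁ q.2 q.1 :=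
  (continuous_sn.mul continuous_dn).sub
    (((continuous_jacobiEpsilon.const_mul 2).sub continuous_snd).mul continuous_cn)

theorem am_mem_Ioo {k : ℝ} (hk : k ∈ Ioo (0 : ℝ) 1) {p : ℝ} (hp : p ∈ Ioo 0 (ellK k)) :
    am p k ∈ Ioo 0 (Real.pi / 2) :=
  ⟨(lt_am_iff hk).2 (by simpa using hp.1), (am_lt_iff hk).2 hp.2⟩

/-- The quotient `f₁ / cn` vanishes at `0` and has derivative `sn² dn² / cn²`, positive on `(0, K)`,
where `cn > 0`. -/
theorem f₁_pos {k : ℝ} (hk : k ∈ Ioo (0 : ℝ) 1) {p : ℝ} (hp : p ∈ Ioo 0 (ellK k)) :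
    0 < f₁ p k := by
  have hcn : ∀ x ∈ Icc 0 p, 0 < cn x k := fun x hx => Real.cos_pos_of_mem_Ioo
    ⟨(lt_am_iff hk).2 (by
        rw [ellF_neg hk]; change -ellK k < x; linarith [hx.1, ellK_pos hk]),
      (am_lt_iff hk).2 (hx.2.trans_lt hp.2)⟩
  have hder : ∀ x ∈ Icc 0 p,
      HasDerivAt (fun x => f₁ x k / cn x k) (sn x k ^ 2 * dn x k ^ 2 / cn x k ^ 2) x :=
    fun x hx => by
    refine ((hasDerivAt_f₁ hk x).div (hasDerivAt_cn hk x) (hcn x hx).ne').congr_deriv ?_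
    congr 1
    rw [f₁]
    ring
  have hmono : StrictMonoOn (fun x => f₁ x k / cn x k) (Icc 0 p) := by
    refine strictMonoOn_of_deriv_pos (convex_Icc _ _)
      (fun x hx => (hder x hx).continuousAt.continuousWithinAt) fun x hx => ?_
    rw [interior_Icc] at hx
    rw [(hder x (Ioo_subset_Icc_self hx)).deriv]
    have ha := am_mem_Ioo hk ⟨hx.1, hx.2.trans hp.2⟩
    have hs : 0 < sn x k := Real.sin_pos_of_pos_of_lt_pi ha.1 (by linarith [ha.2, Real.pi_pos])
    have hd := dn_pos hk x
    have hc := hcn x (Ioo_subset_Icc_self hx)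
    positivity
  have h := hmono (left_mem_Icc.2 hp.1.le) (right_mem_Icc.2 hp.1.le) hp.1
  have h0 : f₁ 0 k = 0 := by simp [f₁, sn, am_zero hk, jacobiEpsilon]
  simp only [h0, zero_div] at h
  exact (div_pos_iff_of_pos_right (hcn p (right_mem_Icc.2 hp.1.le))).1 h

/-- At `K` and `3K` one has `cn = 0` and `sn = ±1`, so `f₁` equals `dn` and `-dn` there.
Nonemptiness matters because `sInf ∅ = 0` would spoil every lower bound on `p₁₁`. -/
theorem exists_root_f₁ {k : ℝ} (hk : k ∈ Ioo (0 : ℝ) 1) :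
    {p : ℝ | 0 < p ∧ f₁ p k = 0}.Nonempty := by
  have hK := ellK_pos hk
  have h1 : 0 < f₁ (ellK k) k := by
    have := dn_pos hk (ellK k)
    simpa [f₁, sn, cn, am_ellK hk] using this
  have h3 : f₁ (3 * ellK k) k < 0 := by
    have ham : am (3 * ellK k) k = 3 * Real.pi / 2 := by
      rw [← ellF_three_pi_div_two hk, am_ellF hk]
    have := dn_pos hk (3 * ellK k)
    have hc : Real.cos (3 * Real.pi / 2) = 0 := by
      rw [show 3 * Real.pi / 2 = Real.pi / 2 + Real.pi by ring, Real.cos_add_pi]; simp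
    have hs : Real.sin (3 * Real.pi / 2) = -1 := by
      rw [show 3 * Real.pi / 2 = Real.pi / 2 + Real.pi by ring, Real.sin_add_pi]; simp
    simpa [f₁, sn, cn, ham, hs, hc] using this
  have hc : ContinuousOn (fun p => f₁ p k) (Icc (ellK k) (3 * ellK k)) := fun p _ =>
    (hasDerivAt_f₁ hk p).continuousAt.continuousWithinAt
  obtain ⟨p, hp, hp0⟩ := intermediate_value_Icc' (by linarith) hc ⟨h3.le, h1.le⟩
  exact ⟨p, hK.trans_le hp.1, hp0⟩

theorem le_p₁₁ {k q : ℝ} (hk : k ∈ Ioo (0 : ℝ) 1) (h : ∀ x ∈ Ioo 0 q, f₁ x k ≠ 0) : q ≤ p₁₁ k :=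
  le_csInf (exists_root_f₁ hk) fun x hx => not_lt.1 fun hlt => h x ⟨hx.1, hlt⟩ hx.2

theorem f₁_ne_zero {k x : ℝ} (hx : x ∈ Ioo 0 (p₁₁ k)) : f₁ x k ≠ 0 := fun h =>
  notMem_of_lt_csInf hx.2 ⟨0, fun _ hy => hy.1.le⟩ ⟨hx.1, h⟩

theorem ellK_le_p₁ {k : ℝ} (hk : k ∈ Ioo (0 : ℝ) 1) : ellK k ≤ p₁ k :=
  le_min (by linarith [ellK_pos hk]) (le_p₁₁ hk fun _ hx => (f₁_pos hk hx).ne')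

/-- `p₁₁` is lower semicontinuous on `(0, 1)`. -/
theorem eventually_lt_p₁₁ (k : Ioo (0 : ℝ) 1) {p : ℝ} (hp : p < p₁₁ k) :
    ∀ᶠ k' : Ioo (0 : ℝ) 1 in 𝓝 k, p < p₁₁ k' := by
  obtain ⟨q, hpq, hq⟩ := exists_between hp
  have hK : 0 < ellK k := ellK_pos k.2
  -- Compactness cannot be used down to `0`, where `f₁` vanishes. The interval is cut at `K(k)/2`;
  -- below it `f₁_pos` applies for all `k'` with `K(k') > K(k)/2`.
  have hcpt : ∀ᶠ k' : Ioo (0 : ℝ) 1 in 𝓝 k, ∀ x ∈ Icc (ellK k / 2) q, f₁ x k' ≠ 0 := by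
    refine isCompact_Icc.eventually_forall_of_forall_eventually fun x hx => ?_
    exact continuous_f₁.continuousAt.eventually_ne
      (f₁_ne_zero ⟨by linarith [hx.1], hx.2.trans_lt hq⟩)
  have hKev : ∀ᶠ k' : Ioo (0 : ℝ) 1 in 𝓝 k, ellK k / 2 < ellK k' :=
    continuous_ellK.continuousAt.eventually (lt_mem_nhds (by linarith))
  filter_upwards [hcpt, hKev] with k' h1 h2
  refine hpq.trans_le (le_p₁₁ k'.2 fun x hx => ?_)
  rcases lt_or_ge x (ellK k / 2) with h | h
  · exact (f₁_pos k'.2 ⟨hx.1, h.trans h2⟩).ne'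
  · exact h1 x ⟨h, hx.2.le⟩

theorem eventually_lt_p₁ (k : Ioo (0 : ℝ) 1) {p : ℝ} (hp : p < p₁ k) :
    ∀ᶠ k' : Ioo (0 : ℝ) 1 in 𝓝 k, p < p₁ k' := by
  obtain ⟨h1, h2⟩ := lt_min_iff.1 hp
  have hK : ∀ᶠ k' : Ioo (0 : ℝ) 1 in 𝓝 k, p < 2 * ellK k' :=
    (continuous_ellK.const_mul 2).continuousAt.eventually (lt_mem_nhds h1)
  filter_upwards [hK, eventually_lt_p₁₁ k h2] with k' h h' using lt_min h h'

/-! ### The vertical Hamiltonian system in the coordinates `(h₁, h₃, h₂)` -/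

/-- The right-hand side of `ḣ₁ = -h₂ h₃`, `ḣ₃ = h₁ h₂`, `ḣ₂ = h₃`, that is, of the pendulum
equation `β̇ = c`, `ċ = -r sin β`, `ṙ = 0`. -/
def pendulum (q : ℝ × ℝ × ℝ) : ℝ × ℝ × ℝ := (-(q.2.2 * q.2.1), q.1 * q.2.2, q.2.1)

def IsTrajectory (γ : ℝ → ℝ × ℝ × ℝ) : Prop := ∀ t, HasDerivAt γ (pendulum (γ t)) t

theorem isTrajectory_iff {x y z : ℝ → ℝ} : IsTrajectory (fun t => (x t, y t, z t)) ↔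
    ∀ t, HasDerivAt x (-(z t * y t)) t ∧ HasDerivAt y (x t * z t) t ∧ HasDerivAt z (y t) t := by
  refine forall_congr' fun t => ⟨fun h => ⟨h.fst, h.snd.fst, h.snd.snd⟩, fun h => ?_⟩
  exact h.1.prodMk (h.2.1.prodMk h.2.2)

theorem IsTrajectory.components {γ : ℝ → ℝ × ℝ × ℝ} (h : IsTrajectory γ) (t : ℝ) :
    HasDerivAt (fun t => (γ t).1) (-((γ t).2.2 * (γ t).2.1)) t ∧
      HasDerivAt (fun t => (γ t).2.1) ((γ t).1 * (γ t).2.2) t ∧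
      HasDerivAt (fun t => (γ t).2.2) (γ t).2.1 t :=
  isTrajectory_iff.1 h t

theorem IsTrajectory.comp_add {γ : ℝ → ℝ × ℝ × ℝ} (h : IsTrajectory γ) (s : ℝ) :
    IsTrajectory fun t => γ (t + s) := fun t => (h (t + s)).comp_add_const t s

theorem isTrajectory_const {q : ℝ × ℝ × ℝ} (h : pendulum q = 0) : IsTrajectory fun _ => q :=
  fun t => h ▸ hasDerivAt_const t q

theorem IsTrajectory.sq_add_sq_eq {γ : ℝ → ℝ × ℝ × ℝ} (h : IsTrajectory γ) (t : ℝ) :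
    (γ t).1 ^ 2 + (γ t).2.1 ^ 2 = (γ 0).1 ^ 2 + (γ 0).2.1 ^ 2 := by
  have hd : ∀ t, HasDerivAt (fun t => (γ t).1 ^ 2 + (γ t).2.1 ^ 2) 0 t := fun t => by
    obtain ⟨hx, hy, -⟩ := h.components t
    exact ((hx.pow 2).add (hy.pow 2)).congr_deriv (by push_cast; ring)
  exact is_const_of_deriv_eq_zero (fun t => (hd t).differentiableAt) (fun t => (hd t).deriv) t 0

theorem IsTrajectory.energy_eq {γ : ℝ → ℝ × ℝ × ℝ} (h : IsTrajectory γ) (t : ℝ) :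
    (γ t).2.2 ^ 2 / 2 + (γ t).1 = (γ 0).2.2 ^ 2 / 2 + (γ 0).1 := by
  have hd : ∀ t, HasDerivAt (fun t => (γ t).2.2 ^ 2 / 2 + (γ t).1) 0 t := fun t => by
    obtain ⟨hx, -, hz⟩ := h.components t
    exact (((hz.pow 2).div_const 2).add hx).congr_deriv (by push_cast; ring)
  exact is_const_of_deriv_eq_zero (fun t => (hd t).differentiableAt) (fun t => (hd t).deriv) t 0

theorem norm_triple_le_iff {q : ℝ × ℝ × ℝ} {R : ℝ} :
    ‖q‖ ≤ R ↔ |q.1| ≤ R ∧ |q.2.1| ≤ R ∧ |q.2.2| ≤ R := by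
  simp [Prod.norm_def]

/-- The first integral `h₁² + h₃²` bounds `h₁` and `h₃`, and then the energy bounds `h₂`. This
confines trajectories to a ball on which the quadratic vector field is Lipschitz. -/
theorem IsTrajectory.norm_le {γ : ℝ → ℝ × ℝ × ℝ} (h : IsTrajectory γ) {ρ : ℝ} (h0 : ‖γ 0‖ ≤ ρ)
    (t : ℝ) : ‖γ t‖ ≤ 2 * ρ + 3 := by
  have hρ : 0 ≤ ρ := (norm_nonneg _).trans h0
  obtain ⟨hx, hy, hz⟩ := norm_triple_le_iff.1 h0
  have hx2 := sq_le_sq' (abs_le.1 hx).1 (abs_le.1 hx).2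
  have hy2 := sq_le_sq' (abs_le.1 hy).1 (abs_le.1 hy).2
  have hz2 := sq_le_sq' (abs_le.1 hz).1 (abs_le.1 hz).2
  have h1 := h.sq_add_sq_eq t
  have h2 := h.energy_eq t
  have hX : |(γ t).1| ≤ 2 * ρ :=
    abs_le_of_sq_le_sq (by nlinarith [sq_nonneg (γ t).2.1]) (by linarith)
  have hY : |(γ t).2.1| ≤ 2 * ρ :=
    abs_le_of_sq_le_sq (by nlinarith [sq_nonneg (γ t).1]) (by linarith)
  refine norm_triple_le_iff.2 ⟨by linarith, by linarith, ?_⟩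
  refine abs_le_of_sq_le_sq ?_ (by linarith)
  nlinarith [(abs_le.1 hX).1, (abs_le.1 hx).2]

theorem dist_pendulum_le {R : ℝ} {q q' : ℝ × ℝ × ℝ} (hq : ‖q‖ ≤ R) (hq' : ‖q'‖ ≤ R) :
    dist (pendulum q) (pendulum q') ≤ (2 * R + 1) * dist q q' := by
  obtain ⟨hx, hy, hz⟩ := norm_triple_le_iff.1 hq
  obtain ⟨hx', hy', hz'⟩ := norm_triple_le_iff.1 hq'
  have hR : 0 ≤ R := (norm_nonneg _).trans hq
  set d := dist q q' with hd
  have hd0 : 0 ≤ d := dist_nonneg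
  obtain ⟨dx, dy, dz⟩ := norm_triple_le_iff.1 ((dist_eq_norm q q').symm.le)
  rw [← hd] at dx dy dz
  simp only [Prod.fst_sub, Prod.snd_sub] at dx dy dz
  have key : ∀ a b a' b' : ℝ, |a'| ≤ R → |b| ≤ R → |a - a'| ≤ d → |b - b'| ≤ d →
      |a * b - a' * b'| ≤ (2 * R + 1) * d := fun a b a' b' ha hb hda hdb => by
    have : a * b - a' * b' = (a - a') * b + a' * (b - b') := by ring
    rw [this]
    refine (abs_add_le _ _).trans ?_
    rw [abs_mul, abs_mul]
    have h1 := mul_le_mul hda hb (abs_nonneg _) hd0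
    have h2 := mul_le_mul ha hdb (abs_nonneg _) hR
    linarith
  rw [dist_eq_norm, norm_triple_le_iff]
  simp only [pendulum, Prod.fst_sub, Prod.snd_sub]
  refine ⟨?_, key _ _ _ _ hx' hz dx dz, by nlinarith⟩
  have := key _ _ _ _ hz' hy dz dy
  rwa [neg_sub_neg, abs_sub_comm]

theorem IsTrajectory.dist_le {γ δ : ℝ → ℝ × ℝ × ℝ} (hγ : IsTrajectory γ) (hδ : IsTrajectory δ)
    {ρ : ℝ} (hγ0 : ‖γ 0‖ ≤ ρ) (hδ0 : ‖δ 0‖ ≤ ρ) (t : ℝ) :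
    dist (γ t) (δ t) ≤ dist (γ 0) (δ 0) * Real.exp (|t| * (4 * ρ + 7)) := by
  have hρ : 0 ≤ ρ := (norm_nonneg _).trans hγ0
  -- Rescaling time by `t` reduces both signs of `t` to one Grönwall estimate on `[0, 1]`. The
  -- constant `4ρ + 7` is `2R + 1` with `R = 2ρ + 3`.
  have hresc : ∀ {f : ℝ → ℝ × ℝ × ℝ}, IsTrajectory f → ∀ s,
      HasDerivAt (fun s => f (t * s)) (t • pendulum (f (t * s))) s := fun hf s => by
    exact (hf (t * s)).scomp s (((hasDerivAt_id s).const_mul t).congr_deriv (mul_one t))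
  have hLip : LipschitzOnWith (Real.toNNReal (|t| * (4 * ρ + 7))) (fun q => t • pendulum q)
      {q | ‖q‖ ≤ 2 * ρ + 3} := by
    refine LipschitzOnWith.of_dist_le_mul fun q hq q' hq' => ?_
    rw [Real.coe_toNNReal _ (by positivity), dist_smul₀, Real.norm_eq_abs, mul_assoc]
    refine mul_le_mul_of_nonneg_left ?_ (abs_nonneg t)
    refine (dist_pendulum_le hq hq').trans_eq ?_
    ring
  have h := dist_le_of_trajectories_ODE_of_mem (a := 0) (b := 1)
    (v := fun _ q => t • pendulum q) (s := fun _ => {q | ‖q‖ ≤ 2 * ρ + 3})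
    (fun _ _ => hLip)
    (fun s _ => (hresc hγ s).continuousAt.continuousWithinAt)
    (fun s _ => (hresc hγ s).hasDerivWithinAt) (fun s _ => hγ.norm_le hγ0 _)
    (fun s _ => (hresc hδ s).continuousAt.continuousWithinAt)
    (fun s _ => (hresc hδ s).hasDerivWithinAt) (fun s _ => hδ.norm_le hδ0 _)
    le_rfl 1 ⟨zero_le_one, le_rfl⟩
  rw [Real.coe_toNNReal _ (by positivity)] at h
  simpa using h

theorem IsTrajectory.unique {γ δ : ℝ → ℝ × ℝ × ℝ} (hγ : IsTrajectory γ) (hδ : IsTrajectory δ)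
    (h0 : γ 0 = δ 0) : γ = δ := by
  funext t
  have h := hγ.dist_le hδ le_rfl (ρ := ‖γ 0‖) (by rw [h0]) t
  rw [h0, dist_self, zero_mul] at h
  exact dist_le_zero.1 h

/-! ### Explicit trajectories -/

/-- The state `(h₁, h₃, h₂)` of an oscillating pendulum with `√r = 2p`. -/
noncomputable def oscState (k p u : ℝ) : ℝ × ℝ × ℝ :=
  (-(4 * p ^ 2) * (1 - 2 * k ^ 2 * sn u k ^ 2), -(8 * p ^ 2) * k * sn u k * dn u k,
    4 * k * p * cn u k)

/-- The state `(h₁, h₃, h₂)` of a rotating pendulum with `√r = 2kp`. -/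
noncomputable def rotState (s k p u : ℝ) : ℝ × ℝ × ℝ :=
  (-(4 * k ^ 2 * p ^ 2) * (1 - 2 * sn u k ^ 2), -(8 * k ^ 2 * p ^ 2) * s * sn u k * cn u k,
    4 * s * p * dn u k)

/-- The state `(h₁, h₃, h₂)` of a pendulum on the separatrix with `√r = 2p`. -/
noncomputable def sepState (s p u : ℝ) : ℝ × ℝ × ℝ :=
  (-(4 * p ^ 2) * (1 - 2 * Real.tanh u ^ 2), -(8 * p ^ 2) * s * Real.tanh u * (1 / Real.cosh u),
    4 * s * p * (1 / Real.cosh u))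

theorem hasDerivAt_affine (a b t : ℝ) : HasDerivAt (fun t : ℝ => a * t + b) a t := by
  simpa using ((hasDerivAt_id t).const_mul a).add_const b

theorem isTrajectory_oscState {k : ℝ} (hk : k ∈ Ioo (0 : ℝ) 1) (p u : ℝ) :
    IsTrajectory fun t => oscState k p (2 * p * t + u) := by
  refine isTrajectory_iff.2 fun t => ?_
  have hu := hasDerivAt_affine (2 * p) u t
  have hs := (hasDerivAt_sn hk (2 * p * t + u)).comp t hu
  have hc := (hasDerivAt_cn hk (2 * p * t + u)).comp t hu
  have hd := (hasDerivAt_dn hk (2 * p * t + u)).comp t hu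
  have hd2 := dn_sq hk (2 * p * t + u)
  refine ⟨?_, ?_, ?_⟩
  · refine ((((hs.pow 2).const_mul (2 * k ^ 2)).const_sub 1).const_mul
      (-(4 * p ^ 2))).congr_deriv ?_
    simp only [Function.comp]
    push_cast
    ring
  · refine ((hs.const_mul (-(8 * p ^ 2) * k)).mul hd).congr_deriv ?_
    simp only [Function.comp]
    linear_combination (-16 * p ^ 3 * k * cn (2 * p * t + u) k) * hd2
  · refine (hc.const_mul (4 * k * p)).congr_deriv ?_
    ring

theorem isTrajectory_rotState {k : ℝ} (hk : k ∈ Ioo (0 : ℝ) 1) {s : ℝ} (hs2 : s ^ 2 = 1)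
    (p u : ℝ) : IsTrajectory fun t => rotState s k p (2 * p * t + u) := by
  refine isTrajectory_iff.2 fun t => ?_
  have hu := hasDerivAt_affine (2 * p) u t
  have hs := (hasDerivAt_sn hk (2 * p * t + u)).comp t hu
  have hc := (hasDerivAt_cn hk (2 * p * t + u)).comp t hu
  have hd := (hasDerivAt_dn hk (2 * p * t + u)).comp t hu
  have hc2 := sn_sq_add_cn_sq (2 * p * t + u) k
  refine ⟨?_, ?_, ?_⟩
  · refine ((((hs.pow 2).const_mul 2).const_sub 1).const_mul
      (-(4 * k ^ 2 * p ^ 2))).congr_deriv ?_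
    simp only [Function.comp]
    push_cast
    linear_combination (-32 * k ^ 2 * p ^ 3 * sn (2 * p * t + u) k * cn (2 * p * t + u) k *
      dn (2 * p * t + u) k) * hs2
  · refine ((hs.const_mul (-(8 * k ^ 2 * p ^ 2) * s)).mul hc).congr_deriv ?_
    simp only [Function.comp]
    linear_combination (-16 * k ^ 2 * p ^ 3 * s * dn (2 * p * t + u) k) * hc2
  · refine (hd.const_mul (4 * s * p)).congr_deriv ?_
    ring

theorem hasDerivAt_tanh (u : ℝ) : HasDerivAt Real.tanh ((1 / Real.cosh u) ^ 2) u := by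
  have h := (Real.hasDerivAt_sinh u).div (Real.hasDerivAt_cosh u) (Real.cosh_pos u).ne'
  rw [show Real.tanh = fun u => Real.sinh u / Real.cosh u from
    funext Real.tanh_eq_sinh_div_cosh]
  refine h.congr_deriv ?_
  rw [div_pow, one_pow]
  congr 1
  linear_combination Real.cosh_sq u

theorem hasDerivAt_one_div_cosh (u : ℝ) :
    HasDerivAt (fun u => 1 / Real.cosh u) (-(Real.tanh u * (1 / Real.cosh u))) u := by
  have h := (Real.hasDerivAt_cosh u).inv (Real.cosh_pos u).ne'
  simp only [one_div]
  refine h.congr_deriv ?_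
  rw [Real.tanh_eq_sinh_div_cosh]
  have := Real.cosh_pos u
  field_simp

theorem tanh_sq_add (u : ℝ) : Real.tanh u ^ 2 + (1 / Real.cosh u) ^ 2 = 1 := by
  have := Real.cosh_pos u
  rw [Real.tanh_eq_sinh_div_cosh, div_pow, div_pow, ← add_div, one_pow, ← Real.cosh_sq]
  exact div_self (by positivity)

theorem isTrajectory_sepState {s : ℝ} (hs2 : s ^ 2 = 1) (p u : ℝ) :
    IsTrajectory fun t => sepState s p (2 * p * t + u) := by
  refine isTrajectory_iff.2 fun t => ?_
  have hu := hasDerivAt_affine (2 * p) u t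
  have hs := (hasDerivAt_tanh (2 * p * t + u)).comp t hu
  have hc := (hasDerivAt_one_div_cosh (2 * p * t + u)).comp t hu
  have hc2 := tanh_sq_add (2 * p * t + u)
  refine ⟨?_, ?_, ?_⟩
  · refine ((((hs.pow 2).const_mul 2).const_sub 1).const_mul (-(4 * p ^ 2))).congr_deriv ?_
    simp only [Function.comp]
    push_cast
    linear_combination (-32 * p ^ 3 * Real.tanh (2 * p * t + u) *
      (1 / Real.cosh (2 * p * t + u)) ^ 2) * hs2
  · refine ((hs.const_mul (-(8 * p ^ 2) * s)).mul hc).congr_deriv ?_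
    simp only [Function.comp]
    linear_combination (-16 * p ^ 3 * s * (1 / Real.cosh (2 * p * t + u))) * hc2
  · refine (hc.const_mul (4 * s * p)).congr_deriv ?_
    ring

/-! ### Invariants and surjectivity of the elliptic coordinates -/

noncomputable def radius (q : ℝ × ℝ × ℝ) : ℝ := √(q.1 ^ 2 + q.2.1 ^ 2)

noncomputable def totalEnergy (q : ℝ × ℝ × ℝ) : ℝ := q.2.2 ^ 2 / 2 + q.1

theorem radius_nonneg (q : ℝ × ℝ × ℝ) : 0 ≤ radius q := Real.sqrt_nonneg _

theorem radius_eq {q : ℝ × ℝ × ℝ} {r : ℝ} (hr : 0 ≤ r) (h : q.1 ^ 2 + q.2.1 ^ 2 = r ^ 2) :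
    radius q = r := by
  rw [radius, h, Real.sqrt_sq hr]

theorem radius_oscState {k : ℝ} (hk : k ∈ Ioo (0 : ℝ) 1) (p u : ℝ) :
    radius (oscState k p u) = 4 * p ^ 2 := by
  refine radius_eq (by positivity) ?_
  simp only [oscState]
  linear_combination (64 * p ^ 4 * k ^ 2 * sn u k ^ 2) * dn_sq hk u

theorem totalEnergy_oscState (k p u : ℝ) :
    totalEnergy (oscState k p u) = 8 * k ^ 2 * p ^ 2 - 4 * p ^ 2 := by
  simp only [oscState, totalEnergy]
  linear_combination (8 * k ^ 2 * p ^ 2) * sn_sq_add_cn_sq u k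

theorem radius_rotState {s : ℝ} (hs : s ^ 2 = 1) (k p u : ℝ) :
    radius (rotState s k p u) = 4 * k ^ 2 * p ^ 2 := by
  refine radius_eq (by positivity) ?_
  simp only [rotState]
  linear_combination (64 * p ^ 4 * k ^ 4 * sn u k ^ 2) * sn_sq_add_cn_sq u k +
    (64 * p ^ 4 * k ^ 4 * sn u k ^ 2 * cn u k ^ 2) * hs

theorem totalEnergy_rotState {k : ℝ} (hk : k ∈ Ioo (0 : ℝ) 1) {s : ℝ} (hs : s ^ 2 = 1) (p u : ℝ) :
    totalEnergy (rotState s k p u) = 8 * p ^ 2 - 4 * k ^ 2 * p ^ 2 := by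
  simp only [rotState, totalEnergy]
  linear_combination (8 * p ^ 2) * dn_sq hk u + (8 * p ^ 2 * dn u k ^ 2) * hs

theorem radius_sepState {s : ℝ} (hs : s ^ 2 = 1) (p u : ℝ) :
    radius (sepState s p u) = 4 * p ^ 2 := by
  refine radius_eq (by positivity) ?_
  simp only [sepState]
  linear_combination (64 * p ^ 4 * Real.tanh u ^ 2) * tanh_sq_add u +
    (64 * p ^ 4 * Real.tanh u ^ 2 * (1 / Real.cosh u) ^ 2) * hs

theorem totalEnergy_sepState {s : ℝ} (hs : s ^ 2 = 1) (p u : ℝ) :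
    totalEnergy (sepState s p u) = 4 * p ^ 2 := by
  simp only [sepState, totalEnergy]
  linear_combination (8 * p ^ 2) * tanh_sq_add u + (8 * p ^ 2 * (1 / Real.cosh u) ^ 2) * hs

theorem exists_cos_sin_eq {x y : ℝ} (h : x ^ 2 + y ^ 2 = 1) :
    ∃ ψ, Real.cos ψ = x ∧ Real.sin ψ = y := by
  have hn : ‖(⟨x, y⟩ : ℂ)‖ = 1 := by
    rw [Complex.norm_def, Complex.normSq_apply, ← sq, ← sq, h, Real.sqrt_one]
  have h1 := Complex.norm_mul_cos_arg ⟨x, y⟩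
  have h2 := Complex.norm_mul_sin_arg ⟨x, y⟩
  rw [hn, one_mul] at h1 h2
  exact ⟨_, h1, h2⟩

/-- Half-angle coordinates: `A = sin (β / 2)`, `B = cos (β / 2)` for `β ∈ (-π, π]`. -/
theorem exists_half_angle (q : ℝ × ℝ × ℝ) : ∃ A B : ℝ, A ^ 2 + B ^ 2 = 1 ∧ 0 ≤ B ∧
    q.1 = -radius q * (1 - 2 * A ^ 2) ∧ q.2.1 = -(2 * radius q) * A * B := by
  have hn : ‖(⟨-q.1, -q.2.1⟩ : ℂ)‖ = radius q := by
    rw [Complex.norm_def, Complex.normSq_apply, radius]; congr 1; ring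
  have h1 := Complex.norm_mul_cos_arg ⟨-q.1, -q.2.1⟩
  have h2 := Complex.norm_mul_sin_arg ⟨-q.1, -q.2.1⟩
  have h3 := Complex.neg_pi_lt_arg ⟨-q.1, -q.2.1⟩
  have h4 := Complex.arg_le_pi ⟨-q.1, -q.2.1⟩
  rw [hn] at h1 h2
  set b := Complex.arg ⟨-q.1, -q.2.1⟩ with hb
  have hb2 : b = 2 * (b / 2) := by ring
  refine ⟨Real.sin (b / 2), Real.cos (b / 2), Real.sin_sq_add_cos_sq _,
    Real.cos_nonneg_of_neg_pi_div_two_le_of_le (by linarith) (by linarith), ?_, ?_⟩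
  · rw [hb2, Real.cos_two_mul] at h1
    simp only at h1
    linear_combination h1 - 2 * radius q * Real.sin_sq_add_cos_sq (b / 2)
  · rw [hb2, Real.sin_two_mul] at h2
    simp only at h2
    linear_combination h2

theorem radius_pos_of {q : ℝ × ℝ × ℝ} (h : ¬(q.1 = 0 ∧ q.2.1 = 0)) : 0 < radius q := by
  refine Real.sqrt_pos.2 ?_
  rcases not_and_or.1 h with h | h
  · have := sq_pos_of_ne_zero h; positivity
  · have := sq_pos_of_ne_zero h; positivity

/-- The modulus comes from `k² = (E + r) / (2r)`, positive because `hq` excludes the lower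
equilibrium. Only the values `A`, `C` of `sn`, `cn` are prescribed, leaving the phase free to be
chosen later in a given quarter period. -/
theorem exists_oscState {q : ℝ × ℝ × ℝ} (hr : 0 < radius q) (hq : ¬(q.2.1 = 0 ∧ q.2.2 = 0))
    (hE : totalEnergy q < radius q) : ∃ k ∈ Ioo (0 : ℝ) 1, ∃ p > 0, ∃ A C : ℝ, C ^ 2 + A ^ 2 = 1 ∧
      ∀ u, sn u k = A → cn u k = C → oscState k p u = q := by
  obtain ⟨A, B, hAB, hB, hx, hy⟩ := exists_half_angle q
  set r := radius q with hrdef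
  set e := q.2.2 ^ 2 / 4 + r * A ^ 2 with he
  have hEe : totalEnergy q + r = 2 * e := by rw [totalEnergy, he]; linear_combination hx
  have hepos : 0 < e := by
    rcases not_and_or.1 hq with h | h
    · have hA : A ≠ 0 := fun hA => h (by rw [hy, hA]; ring)
      have := sq_pos_of_ne_zero hA
      positivity
    · have := sq_pos_of_ne_zero h
      positivity
  have her : e < r := by linarith
  have hk0 : 0 < √(e / r) := Real.sqrt_pos.2 (by positivity)
  have hksq : √(e / r) ^ 2 = e / r := Real.sq_sqrt (by positivity)
  have hk1 : √(e / r) < 1 := by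
    rw [Real.sqrt_lt' one_pos, one_pow, div_lt_one hr]; exact her
  have hrt : 0 < √r := Real.sqrt_pos.2 hr
  have hrtsq : √r ^ 2 = r := Real.sq_sqrt hr.le
  set k := √(e / r) with hk
  have hke : k ^ 2 * r = e := by rw [hksq]; field_simp
  refine ⟨k, ⟨hk0, hk1⟩, √r / 2, by positivity, A / k, q.2.2 / (2 * k * √r), ?_, ?_⟩
  · have : (q.2.2 / (2 * k * √r)) ^ 2 + (A / k) ^ 2 =
        (q.2.2 ^ 2 / 4 + r * A ^ 2) / (k ^ 2 * r) := by
      rw [div_pow, mul_pow, mul_pow, hrtsq]; field_simp; ring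
    rw [this, hke, ← he, div_self hepos.ne']
  · intro u hs hc
    have hd : dn u k = B := by
      rw [dn, hs, div_pow, mul_div_cancel₀ _ (by positivity), show 1 - A ^ 2 = B ^ 2 by linarith,
        Real.sqrt_sq hB]
    refine Prod.ext ?_ (Prod.ext ?_ ?_)
    · simp only [oscState]
      rw [hs, hx, div_pow, div_pow, hrtsq]
      field_simp
      ring
    · simp only [oscState]
      rw [hs, hd, hy, div_pow, hrtsq]
      field_simp
      ring
    · simp only [oscState]
      rw [hc]
      field_simp
      ring

/-- Here `k² = 2r / (E + r)` and `s` is the sign of the velocity. Changing the signs of both `sn`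
and `cn` leaves the state unchanged, so `B ≥ 0` can be arranged; this reflects the period `2K` of
`τ`. -/
theorem exists_rotState {q : ℝ × ℝ × ℝ} (hr : 0 < radius q) (hE : radius q < totalEnergy q) :
    ∃ s : ℝ, (s = 1 ∨ s = -1) ∧ ∃ k ∈ Ioo (0 : ℝ) 1, ∃ p > 0, ∃ A B : ℝ, B ^ 2 + A ^ 2 = 1 ∧ 0 ≤ B ∧
      ∀ u, sn u k = A → cn u k = B → rotState s k p u = q := by
  obtain ⟨A, B, hAB, hB, hx, hy⟩ := exists_half_angle q
  set r := radius q with hrdef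
  set e := q.2.2 ^ 2 / 4 + r * A ^ 2 with he
  have hEe : totalEnergy q + r = 2 * e := by rw [totalEnergy, he]; linear_combination hx
  have her : r < e := by linarith
  have hepos : 0 < e := hr.trans her
  have hk0 : 0 < √(r / e) := Real.sqrt_pos.2 (by positivity)
  have hksq : √(r / e) ^ 2 = r / e := Real.sq_sqrt (by positivity)
  have hk1 : √(r / e) < 1 := by
    rw [Real.sqrt_lt' one_pos, one_pow, div_lt_one hepos]; exact her
  have het : 0 < √e := Real.sqrt_pos.2 hepos
  have hetsq : √e ^ 2 = e := Real.sq_sqrt hepos.le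
  set k := √(r / e) with hk
  have hke : k ^ 2 * e = r := by rw [hksq]; field_simp
  obtain ⟨s, hs, hsz⟩ : ∃ s : ℝ, (s = 1 ∨ s = -1) ∧ s * |q.2.2| = q.2.2 := by
    rcases le_total 0 q.2.2 with h | h
    · exact ⟨1, Or.inl rfl, by rw [abs_of_nonneg h, one_mul]⟩
    · exact ⟨-1, Or.inr rfl, by rw [abs_of_nonpos h]; ring⟩
  have hs2 : s ^ 2 = 1 := by rcases hs with rfl | rfl <;> norm_num
  refine ⟨s, hs, k, ⟨hk0, hk1⟩, √e / 2, by positivity, s * A, B, ?_, hB, fun u hsn hcn => ?_⟩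
  · rw [mul_pow, hs2]; linarith
  · have hd : 2 * √e * dn u k = |q.2.2| := by
      have h1 : (2 * √e * dn u k) ^ 2 = |q.2.2| ^ 2 := by
        rw [mul_pow, mul_pow, hetsq, dn_sq ⟨hk0, hk1⟩, hsn, mul_pow, hs2, sq_abs]
        linear_combination (-4 * A ^ 2) * hke + 4 * he
      exact (sq_eq_sq₀ (by have := dn_pos ⟨hk0, hk1⟩ u; positivity) (abs_nonneg _)).1 h1
    refine Prod.ext ?_ (Prod.ext ?_ ?_)
    · simp only [rotState]
      rw [hsn, hx, mul_pow, hs2, div_pow, hetsq]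
      linear_combination (-(1 - 2 * A ^ 2)) * hke
    · simp only [rotState]
      rw [hsn, hcn, hy, div_pow, hetsq]
      linear_combination (-2 * A * B * s ^ 2) * hke + (-2 * A * B * r) * hs2
    · simp only [rotState]
      linear_combination s * hd + hsz

theorem exists_sepState {q : ℝ × ℝ × ℝ} (hr : 0 < radius q) (hq : ¬(q.2.1 = 0 ∧ q.2.2 = 0))
    (hE : totalEnergy q = radius q) :
    ∃ s : ℝ, (s = 1 ∨ s = -1) ∧ ∃ p > 0, ∃ u, sepState s p u = q := by
  obtain ⟨A, B, hAB, hB, hx, hy⟩ := exists_half_angle q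
  set r := radius q with hrdef
  have hz : q.2.2 ^ 2 = 4 * r * B ^ 2 := by
    rw [totalEnergy] at hE
    linear_combination 2 * hE - 2 * hx - 4 * r * hAB
  have hBpos : 0 < B := by
    refine lt_of_le_of_ne hB fun h => hq ⟨by rw [hy, ← h]; ring, ?_⟩
    rw [← h] at hz
    exact pow_eq_zero_iff (two_ne_zero) |>.1 (by rw [hz]; ring)
  have hrt : 0 < √r := Real.sqrt_pos.2 hr
  have hrtsq : √r ^ 2 = r := Real.sq_sqrt hr.le
  obtain ⟨s, hs, hsz⟩ : ∃ s : ℝ, (s = 1 ∨ s = -1) ∧ s * |q.2.2| = q.2.2 := by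
    rcases le_total 0 q.2.2 with h | h
    · exact ⟨1, Or.inl rfl, by rw [abs_of_nonneg h, one_mul]⟩
    · exact ⟨-1, Or.inr rfl, by rw [abs_of_nonpos h]; ring⟩
  have hs2 : s ^ 2 = 1 := by rcases hs with rfl | rfl <;> norm_num
  have hzabs : |q.2.2| = 2 * √r * B := by
    refine (sq_eq_sq₀ (abs_nonneg _) (by positivity)).1 ?_
    rw [sq_abs, hz, mul_pow, mul_pow, hrtsq]
    ring
  -- The phase must satisfy `tanh u = sA` and `1 / cosh u = B`, hence `sinh u = sA / B`.
  refine ⟨s, hs, √r / 2, by positivity, Real.arsinh (s * A / B), ?_⟩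
  have hcosh : 1 / Real.cosh (Real.arsinh (s * A / B)) = B := by
    rw [Real.cosh_arsinh, div_pow, mul_pow, hs2]
    have : 1 + 1 * A ^ 2 / B ^ 2 = (1 / B) ^ 2 := by
      field_simp; linarith
    rw [this, Real.sqrt_sq (by positivity), one_div_one_div]
  have htanh : Real.tanh (Real.arsinh (s * A / B)) = s * A := by
    rw [Real.tanh_eq_sinh_div_cosh, Real.sinh_arsinh, div_eq_mul_one_div _ (Real.cosh _), hcosh]
    field_simp
  refine Prod.ext ?_ (Prod.ext ?_ ?_)
  · simp only [sepState]
    rw [htanh, hx, mul_pow, hs2, div_pow, hrtsq]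
    ring
  · simp only [sepState]
    rw [htanh, hcosh, hy, div_pow, hrtsq]
    linear_combination (-2 * A * B * r) * hs2
  · simp only [sepState]
    rw [hcosh]
    linear_combination hsz - s * hzabs

/-! ### The flow -/

theorem exists_am_eq {k : ℝ} (hk : k ∈ Ioo (0 : ℝ) 1) {x y : ℝ} (h : x ^ 2 + y ^ 2 = 1) :
    ∃ u, sn u k = y ∧ cn u k = x := by
  obtain ⟨ψ, h1, h2⟩ := exists_cos_sin_eq h
  exact ⟨ellF ψ k, by rw [sn, am_ellF hk, h2], by rw [cn, am_ellF hk, h1]⟩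

theorem sq_eq_one_of {s : ℝ} (hs : s = 1 ∨ s = -1) : s ^ 2 = 1 := by
  rcases hs with rfl | rfl <;> norm_num

/-- Global existence is read off from the explicit solutions: the points with `r = 0` or `h₃ = h₂ =
0` are fixed, and all others lie on an oscillating, separatrix or rotating trajectory according to
the energy. -/
theorem exists_trajectory (q : ℝ × ℝ × ℝ) : ∃ γ, IsTrajectory γ ∧ γ 0 = q := by
  by_cases h1 : q.1 = 0 ∧ q.2.1 = 0
  · exact ⟨fun _ => q, isTrajectory_const (by simp [pendulum, h1.1, h1.2]), rfl⟩
  by_cases h2 : q.2.1 = 0 ∧ q.2.2 = 0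
  · exact ⟨fun _ => q, isTrajectory_const (by simp [pendulum, h2.1, h2.2]), rfl⟩
  have hr := radius_pos_of h1
  rcases lt_trichotomy (totalEnergy q) (radius q) with hE | hE | hE
  · obtain ⟨k, hk, p, -, A, C, hAC, h⟩ := exists_oscState hr h2 hE
    obtain ⟨u, hs, hc⟩ := exists_am_eq hk hAC
    exact ⟨_, isTrajectory_oscState hk p u, by simpa using h u hs hc⟩
  · obtain ⟨s, hs, p, -, u, h⟩ := exists_sepState hr h2 hE
    exact ⟨_, isTrajectory_sepState (sq_eq_one_of hs) p u, by simpa using h⟩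
  · obtain ⟨s, hs, k, hk, p, -, A, B, hAB, -, h⟩ := exists_rotState hr hE
    obtain ⟨u, hsn, hcn⟩ := exists_am_eq hk hAB
    exact ⟨_, isTrajectory_rotState hk (sq_eq_one_of hs) p u, by simpa using h u hsn hcn⟩

/-- The flow of the vertical Hamiltonian system. -/
noncomputable def flow (t : ℝ) (q : ℝ × ℝ × ℝ) : ℝ × ℝ × ℝ := (exists_trajectory q).choose t

theorem isTrajectory_flow (q : ℝ × ℝ × ℝ) : IsTrajectory fun t => flow t q :=
  (exists_trajectory q).choose_spec.1

theorem flow_zero (q : ℝ × ℝ × ℝ) : flow 0 q = q := (exists_trajectory q).choose_spec.2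

theorem IsTrajectory.flow_eq {γ : ℝ → ℝ × ℝ × ℝ} (h : IsTrajectory γ) (t : ℝ) :
    flow t (γ 0) = γ t :=
  congrFun ((isTrajectory_flow (γ 0)).unique h (flow_zero _)) t

theorem flow_add (s t : ℝ) (q : ℝ × ℝ × ℝ) : flow t (flow s q) = flow (t + s) q := by
  have := ((isTrajectory_flow q).comp_add s).flow_eq t
  simpa using this

theorem continuous_flow (t : ℝ) : Continuous (flow t) := by
  refine continuous_iff_continuousAt.2 fun q => ?_
  refine tendsto_iff_dist_tendsto_zero.2 ?_
  have hlim : Tendsto (fun q' => dist q' q * Real.exp (|t| * (4 * (‖q‖ + 1) + 7))) (𝓝 q) (𝓝 0) := by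
    have : Continuous fun q' => dist q' q * Real.exp (|t| * (4 * (‖q‖ + 1) + 7)) := by fun_prop
    simpa using this.tendsto q
  refine squeeze_zero' (Eventually.of_forall fun _ => dist_nonneg) ?_ hlim
  have hev : ∀ᶠ q' in 𝓝 q, ‖q'‖ < ‖q‖ + 1 :=
    continuous_norm.continuousAt.eventually (gt_mem_nhds (lt_add_one _))
  filter_upwards [hev] with q' hq'
  have := (isTrajectory_flow q').dist_le (isTrajectory_flow q) (ρ := ‖q‖ + 1)
    (by rw [flow_zero]; exact hq'.le) (by rw [flow_zero]; linarith) t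
  simpa only [flow_zero] using this

noncomputable def flowHomeomorph (t : ℝ) : (ℝ × ℝ × ℝ) ≃ₜ (ℝ × ℝ × ℝ) where
  toFun := flow t
  invFun := flow (-t)
  left_inv q := by rw [flow_add, neg_add_cancel, flow_zero]
  right_inv q := by rw [flow_add, add_neg_cancel, flow_zero]
  continuous_toFun := continuous_flow t
  continuous_invFun := continuous_flow (-t)

theorem flow_oscState {k : ℝ} (hk : k ∈ Ioo (0 : ℝ) 1) (t p u : ℝ) :
    flow t (oscState k p u) = oscState k p (2 * p * t + u) := by
  simpa using (isTrajectory_oscState hk p u).flow_eq t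

theorem flow_rotState {k : ℝ} (hk : k ∈ Ioo (0 : ℝ) 1) {s : ℝ} (hs : s ^ 2 = 1) (t p u : ℝ) :
    flow t (rotState s k p u) = rotState s k p (2 * p * t + u) := by
  simpa using (isTrajectory_rotState hk hs p u).flow_eq t

theorem flow_sepState {s : ℝ} (hs : s ^ 2 = 1) (t p u : ℝ) :
    flow t (sepState s p u) = sepState s p (2 * p * t + u) := by
  simpa using (isTrajectory_sepState hs p u).flow_eq t

/-! ### The regions of states at the middle of an elastica -/

/-- The modulus of an oscillating pendulum. -/
noncomputable def oscModulus (q : ℝ × ℝ × ℝ) : ℝ :=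
  √((totalEnergy q + radius q) / (2 * radius q))

/-- The modulus of a rotating pendulum. -/
noncomputable def rotModulus (q : ℝ × ℝ × ℝ) : ℝ :=
  √(2 * radius q / (totalEnergy q + radius q))

/-- The bound on `p`, expressed through the first integrals of the pendulum. -/
def Admissible (q : ℝ × ℝ × ℝ) : Prop :=
  (totalEnergy q < radius q → √(radius q) / 2 < p₁ (oscModulus q)) ∧
    (radius q < totalEnergy q → √((totalEnergy q + radius q) / 2) / 2 < ellK (rotModulus q))

theorem admissible_oscState_iff {k : ℝ} (hk : k ∈ Ioo (0 : ℝ) 1) {p : ℝ} (hp : 0 < p) (u : ℝ) :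
    Admissible (oscState k p u) ↔ p < p₁ k := by
  have hk2 : k ^ 2 < 1 := by nlinarith [hk.1, hk.2]
  have hlt : 8 * k ^ 2 * p ^ 2 - 4 * p ^ 2 < 4 * p ^ 2 := by nlinarith [sq_pos_of_pos hp]
  have hm : (8 * k ^ 2 * p ^ 2 - 4 * p ^ 2 + 4 * p ^ 2) / (2 * (4 * p ^ 2)) = k ^ 2 := by
    field_simp; ring
  rw [Admissible, oscModulus, radius_oscState hk, totalEnergy_oscState, hm, Real.sqrt_sq hk.1.le,
    show 4 * p ^ 2 = (2 * p) ^ 2 by ring, Real.sqrt_sq (by positivity)]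
  rw [show 4 * p ^ 2 = (2 * p) ^ 2 by ring] at hlt
  simp only [hlt, hlt.not_gt, forall_const, false_imp_iff, and_true]
  rw [mul_div_cancel_left₀ _ two_ne_zero]

theorem admissible_rotState_iff {k : ℝ} (hk : k ∈ Ioo (0 : ℝ) 1) {s : ℝ} (hs : s ^ 2 = 1) {p : ℝ}
    (hp : 0 < p) (u : ℝ) : Admissible (rotState s k p u) ↔ p < ellK k := by
  have hk2 : k ^ 2 < 1 := by nlinarith [hk.1, hk.2]
  have hlt : 4 * k ^ 2 * p ^ 2 < 8 * p ^ 2 - 4 * k ^ 2 * p ^ 2 := by nlinarith [sq_pos_of_pos hp]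
  have hm : 2 * (4 * k ^ 2 * p ^ 2) / (8 * p ^ 2 - 4 * k ^ 2 * p ^ 2 + 4 * k ^ 2 * p ^ 2) =
      k ^ 2 := by
    rw [sub_add_cancel]; field_simp; ring
  have hp2 : (8 * p ^ 2 - 4 * k ^ 2 * p ^ 2 + 4 * k ^ 2 * p ^ 2) / 2 = (2 * p) ^ 2 := by ring
  rw [Admissible, rotModulus, radius_rotState hs, totalEnergy_rotState hk hs, hm,
    Real.sqrt_sq hk.1.le, hp2, Real.sqrt_sq (by positivity)]
  simp only [hlt, hlt.not_gt, forall_const, false_imp_iff, true_and]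
  rw [mul_div_cancel_left₀ _ two_ne_zero]

/-- Since `E = r`, both implications in `Admissible` are vacuous, in accordance with the range `p ∈
(0, +∞)` on `N₃`. -/
theorem admissible_sepState {s : ℝ} (hs : s ^ 2 = 1) (p u : ℝ) : Admissible (sepState s p u) := by
  simp [Admissible, radius_sepState hs, totalEnergy_sepState hs]

/-- The admissible states with prescribed signs of `h₃` and `h₂`. -/
def region (ε δ : ℝ) : Set (ℝ × ℝ × ℝ) := {q | 0 < ε * q.2.1 ∧ 0 < δ * q.2.2 ∧ Admissible q}

theorem radius_pos {q : ℝ × ℝ × ℝ} (hy : q.2.1 ≠ 0) : 0 < radius q :=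
  radius_pos_of fun h => hy h.2

theorem totalEnergy_add_radius_pos {q : ℝ × ℝ × ℝ} (hy : q.2.1 ≠ 0) :
    0 < totalEnergy q + radius q := by
  have h : |q.1| < radius q := by
    rw [← Real.sqrt_sq_eq_abs]
    exact Real.sqrt_lt_sqrt (sq_nonneg _) (by linarith [sq_pos_of_ne_zero hy])
  rw [totalEnergy]
  nlinarith [neg_abs_le q.1, sq_nonneg q.2.2]

theorem oscModulus_mem_Ioo {q : ℝ × ℝ × ℝ} (hy : q.2.1 ≠ 0) (hE : totalEnergy q < radius q) :
    oscModulus q ∈ Ioo (0 : ℝ) 1 := by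
  have h1 := radius_pos hy
  have h2 := totalEnergy_add_radius_pos hy
  refine ⟨Real.sqrt_pos.2 (by positivity), ?_⟩
  rw [oscModulus, Real.sqrt_lt' one_pos, one_pow, div_lt_one (by positivity)]
  linarith

theorem rotModulus_mem_Ioo {q : ℝ × ℝ × ℝ} (hy : q.2.1 ≠ 0) (hE : radius q < totalEnergy q) :
    rotModulus q ∈ Ioo (0 : ℝ) 1 := by
  have h1 := radius_pos hy
  have h2 := totalEnergy_add_radius_pos hy
  refine ⟨Real.sqrt_pos.2 (by positivity), ?_⟩
  rw [rotModulus, Real.sqrt_lt' one_pos, one_pow, div_lt_one (by positivity)]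
  linarith

theorem continuous_radius : Continuous radius := by unfold radius; fun_prop

theorem continuous_totalEnergy : Continuous totalEnergy := by unfold totalEnergy; fun_prop

theorem continuousAt_oscModulus {q : ℝ × ℝ × ℝ} (hy : q.2.1 ≠ 0) : ContinuousAt oscModulus q := by
  have hr := radius_pos hy
  refine (ContinuousAt.div ?_ ?_ (by positivity)).sqrt
  · exact (continuous_totalEnergy.add continuous_radius).continuousAt
  · exact (continuous_radius.const_mul 2).continuousAt

theorem continuousAt_rotModulus {q : ℝ × ℝ × ℝ} (hy : q.2.1 ≠ 0) : ContinuousAt rotModulus q := by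
  have hr := totalEnergy_add_radius_pos hy
  refine (ContinuousAt.div ?_ ?_ (by positivity)).sqrt
  · exact (continuous_radius.const_mul 2).continuousAt
  · exact (continuous_totalEnergy.add continuous_radius).continuousAt

/-! ### Openness of the regions -/

theorem eventually_nhds_of_subtype {k : ℝ} (hk : k ∈ Ioo (0 : ℝ) 1) {P : ℝ → Prop}
    (h : ∀ᶠ k' : Ioo (0 : ℝ) 1 in 𝓝 ⟨k, hk⟩, P k') : ∀ᶠ k' in 𝓝 k, P k' := by
  have := isOpen_Ioo.isOpenEmbedding_subtypeVal.map_nhds_eq (⟨k, hk⟩ : Ioo (0 : ℝ) 1)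
  rw [← show _ = 𝓝 k from this]
  exact h

theorem eventually_lt_ellK_nhds_one (M : ℝ) : ∀ᶠ k in 𝓝 (1 : ℝ), k < 1 → M < ellK k :=
  eventually_nhdsWithin_iff.1 (tendsto_ellK_one.eventually_gt_atTop M)

theorem eventually_admissible {q : ℝ × ℝ × ℝ} (hy : q.2.1 ≠ 0) (hq : Admissible q) :
    ∀ᶠ q' in 𝓝 q, Admissible q' := by
  have hyev : ∀ᶠ q' : ℝ × ℝ × ℝ in 𝓝 q, q'.2.1 ≠ 0 :=
    (continuous_fst.comp continuous_snd).continuousAt.eventually_ne hy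
  have hosc : Continuous fun q => √(radius q) / 2 := by
    have := continuous_radius
    fun_prop
  have hrot : Continuous fun q => √((totalEnergy q + radius q) / 2) / 2 := by
    have := continuous_radius
    have := continuous_totalEnergy
    fun_prop
  rcases lt_trichotomy (totalEnergy q) (radius q) with hE | hE | hE
  · obtain ⟨M, hM, hM'⟩ := exists_between (hq.1 hE)
    have h1 := (continuousAt_oscModulus hy).eventually
      (eventually_nhds_of_subtype (oscModulus_mem_Ioo hy hE) (P := fun k => M < p₁ k)
        (eventually_lt_p₁ ⟨_, oscModulus_mem_Ioo hy hE⟩ hM'))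
    filter_upwards [h1, hosc.continuousAt.eventually (gt_mem_nhds hM),
      continuous_totalEnergy.continuousAt.eventually_lt continuous_radius.continuousAt hE]
      with q' h1 h2 h3
    exact ⟨fun _ => h2.trans h1, fun h => absurd h h3.not_gt⟩
  -- On the separatrix both moduli equal `1` and both expressions for `p` equal `√r / 2`. At nearby
  -- states `p` stays below `M`, while a modulus close to `1` makes `K`, and with it `p₁ ≥ K`,
  -- exceed `M`.
  · have hr := radius_pos hy
    have hosc1 : oscModulus q = 1 := by
      rw [oscModulus, hE, ← two_mul, div_self (by positivity), Real.sqrt_one]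
    have hrot1 : rotModulus q = 1 := by
      rw [rotModulus, hE, ← two_mul, div_self (by positivity), Real.sqrt_one]
    have hrotval : √((totalEnergy q + radius q) / 2) / 2 = √(radius q) / 2 := by
      rw [hE]; congr 2; ring
    have hM := lt_add_one (√(radius q) / 2)
    set M := √(radius q) / 2 + 1
    have h1 := (continuousAt_oscModulus hy).tendsto
    have h2 := (continuousAt_rotModulus hy).tendsto
    rw [hosc1] at h1
    rw [hrot1] at h2
    filter_upwards [h1.eventually (eventually_lt_ellK_nhds_one M),
      h2.eventually (eventually_lt_ellK_nhds_one M), hyev,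
      hosc.continuousAt.eventually (gt_mem_nhds hM),
      hrot.continuousAt.eventually (gt_mem_nhds (hrotval ▸ hM))] with q' h1 h2 hy' h3 h4
    refine ⟨fun h => ?_, fun h => ?_⟩
    · have hk := oscModulus_mem_Ioo hy' h
      exact h3.trans ((h1 hk.2).trans_le (ellK_le_p₁ hk))
    · exact h4.trans (h2 (rotModulus_mem_Ioo hy' h).2)
  · obtain ⟨M, hM, hM'⟩ := exists_between (hq.2 hE)
    have h1 := (continuousAt_rotModulus hy).eventually
      (eventually_nhds_of_subtype (rotModulus_mem_Ioo hy hE) (P := fun k => M < ellK k)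
        (continuous_ellK.continuousAt.eventually (lt_mem_nhds hM')))
    filter_upwards [h1, hrot.continuousAt.eventually (gt_mem_nhds hM),
      continuous_radius.continuousAt.eventually_lt continuous_totalEnergy.continuousAt hE]
      with q' h1 h2 h3
    exact ⟨fun h => absurd h h3.not_gt, fun _ => h2.trans h1⟩

theorem isOpen_region (ε δ : ℝ) : IsOpen (region ε δ) := by
  refine isOpen_iff_mem_nhds.2 fun q hq => ?_
  have hy : q.2.1 ≠ 0 := fun h => by simpa [h] using hq.1
  have h1 : ∀ᶠ q' : ℝ × ℝ × ℝ in 𝓝 q, 0 < ε * q'.2.1 :=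
    (by fun_prop : Continuous fun q' : ℝ × ℝ × ℝ => ε * q'.2.1).continuousAt.eventually
      (lt_mem_nhds hq.1)
  have h2 : ∀ᶠ q' : ℝ × ℝ × ℝ in 𝓝 q, 0 < δ * q'.2.2 :=
    (by fun_prop : Continuous fun q' : ℝ × ℝ × ℝ => δ * q'.2.2).continuousAt.eventually
      (lt_mem_nhds hq.2.1)
  filter_upwards [h1, h2, eventually_admissible hy hq.2.2] with q' h1 h2 h3 using ⟨h1, h2, h3⟩

/-! ### Dilations and path-connectedness of the regions -/

/-- The anisotropic dilation `r ↦ s² r`, `c ↦ s c` of the pendulum. -/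
def dilate (s : ℝ) (q : ℝ × ℝ × ℝ) : ℝ × ℝ × ℝ := (s ^ 2 * q.1, s ^ 2 * q.2.1, s * q.2.2)

theorem radius_dilate (s : ℝ) (q : ℝ × ℝ × ℝ) : radius (dilate s q) = s ^ 2 * radius q := by
  refine radius_eq (mul_nonneg (sq_nonneg s) (radius_nonneg q)) ?_
  have : radius q ^ 2 = q.1 ^ 2 + q.2.1 ^ 2 := Real.sq_sqrt (by positivity)
  simp only [dilate]
  rw [mul_pow _ (radius q), this]
  ring

theorem totalEnergy_dilate (s : ℝ) (q : ℝ × ℝ × ℝ) :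
    totalEnergy (dilate s q) = s ^ 2 * totalEnergy q := by
  simp only [dilate, totalEnergy]
  ring

theorem Admissible.dilate {q : ℝ × ℝ × ℝ} (hq : Admissible q) {s : ℝ} (hs0 : 0 < s)
    (hs1 : s ≤ 1) : Admissible (dilate s q) := by
  have hs2 : 0 < s ^ 2 := by positivity
  have hle : ∀ a : ℝ, √(s ^ 2 * a) / 2 ≤ √a / 2 := fun a => by
    rw [Real.sqrt_mul hs2.le, Real.sqrt_sq hs0.le]
    nlinarith [Real.sqrt_nonneg a]
  have h1 : oscModulus (Elastica.dilate s q) = oscModulus q := by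
    rw [oscModulus, oscModulus, radius_dilate, totalEnergy_dilate, ← mul_add,
      mul_left_comm 2 (s ^ 2), mul_div_mul_left _ _ hs2.ne']
  have h2 : rotModulus (Elastica.dilate s q) = rotModulus q := by
    rw [rotModulus, rotModulus, radius_dilate, totalEnergy_dilate, ← mul_add,
      mul_left_comm 2 (s ^ 2), mul_div_mul_left _ _ hs2.ne']
  rw [Admissible, h1, h2, radius_dilate, totalEnergy_dilate, ← mul_add, mul_div_assoc,
    mul_lt_mul_iff_right₀ hs2, mul_lt_mul_iff_right₀ hs2]
  exact ⟨fun h => (hle _).trans_lt (hq.1 h), fun h => (hle _).trans_lt (hq.2 h)⟩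

/-- For small states `p < 1 < π/2 ≤ K ≤ p₁`, so the bound on `p` is automatic. -/
theorem admissible_of_norm_lt_one {q : ℝ × ℝ × ℝ} (hy : q.2.1 ≠ 0) (hq : ‖q‖ < 1) :
    Admissible q := by
  obtain ⟨hx, hy1, hz⟩ := norm_triple_le_iff.1 hq.le
  have hr : radius q ≤ 2 := by
    refine Real.sqrt_le_iff.2 ⟨by norm_num, ?_⟩
    nlinarith [sq_le_one_iff_abs_le_one q.1 |>.2 hx, sq_le_one_iff_abs_le_one q.2.1 |>.2 hy1]
  have hE : totalEnergy q ≤ 2 := by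
    rw [totalEnergy]
    linarith [sq_le_one_iff_abs_le_one q.2.2 |>.2 hz, (abs_le.1 hx).2]
  have hsq : ∀ {a : ℝ}, a ≤ 2 → √a / 2 < 1 := fun {a} ha => by
    have : √a < 2 := (Real.sqrt_lt' two_pos).2 (by linarith)
    linarith
  have hK : ∀ {k : ℝ}, k ∈ Ioo (0 : ℝ) 1 → 1 < ellK k := fun hk => by
    linarith [pi_div_two_le_ellK hk, Real.pi_gt_three]
  refine ⟨fun h => ?_, fun h => ?_⟩
  · have hk := oscModulus_mem_Ioo hy h
    exact (hsq hr).trans ((hK hk).trans_le (ellK_le_p₁ hk))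
  · exact (hsq (by linarith)).trans (hK (rotModulus_mem_Ioo hy h))

theorem isPathConnected_region {ε δ : ℝ} (hε : ε ^ 2 = 1) (hδ : δ ^ 2 = 1) :
    IsPathConnected (region ε δ) := by
  have hbox : Convex ℝ {q : ℝ × ℝ × ℝ | 0 < ε * q.2.1 ∧ 0 < δ * q.2.2 ∧ ‖q‖ < 1} := by
    have h1 : IsLinearMap ℝ fun q : ℝ × ℝ × ℝ => ε * q.2.1 :=
      ⟨fun _ _ => by simp [mul_add], fun _ _ => by simp; ring⟩
    have h2 : IsLinearMap ℝ fun q : ℝ × ℝ × ℝ => δ * q.2.2 :=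
      ⟨fun _ _ => by simp [mul_add], fun _ _ => by simp; ring⟩
    have h3 : Convex ℝ {q : ℝ × ℝ × ℝ | ‖q‖ < 1} := by
      simpa [Metric.ball, dist_zero_right] using convex_ball (0 : ℝ × ℝ × ℝ) 1
    exact (convex_halfSpace_gt h1 0).inter ((convex_halfSpace_gt h2 0).inter h3)
  have hsub : {q : ℝ × ℝ × ℝ | 0 < ε * q.2.1 ∧ 0 < δ * q.2.2 ∧ ‖q‖ < 1} ⊆ region ε δ :=
    fun q hq => ⟨hq.1, hq.2.1,
      admissible_of_norm_lt_one (fun h => by simpa [h] using hq.1) hq.2.2⟩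
  have hne : ((0, ε / 2, δ / 2) : ℝ × ℝ × ℝ) ∈
      {q : ℝ × ℝ × ℝ | 0 < ε * q.2.1 ∧ 0 < δ * q.2.2 ∧ ‖q‖ < 1} := by
    have habs : ∀ {a : ℝ}, a ^ 2 = 1 → |a / 2| ≤ 1 / 2 := fun {a} ha =>
      abs_le_of_sq_le_sq (by nlinarith) (by norm_num)
    refine ⟨by simp only; nlinarith, by simp only; nlinarith, ?_⟩
    exact (norm_triple_le_iff.2 ⟨by simp, habs hε, habs hδ⟩).trans_lt one_half_lt_one
  have hpc := hbox.isPathConnected ⟨_, hne⟩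
  have hjoin : ∀ q ∈ region ε δ, JoinedIn (region ε δ) (0, ε / 2, δ / 2) q := fun q hq => by
    have hn : 0 < 1 + ‖q‖ := by positivity
    -- As `s₀ ≤ 1` gives `s₀² ≤ s₀`, the dilated state has norm at most `s₀ ‖q‖ < 1`.
    set s₀ := 1 / (1 + ‖q‖) with hs₀
    have hs0 : 0 < s₀ := by positivity
    have hs1 : s₀ ≤ 1 := by rw [hs₀, div_le_one hn]; linarith [norm_nonneg q]
    have hs : s₀ * ‖q‖ < 1 := by
      rw [hs₀, one_div_mul_eq_div, div_lt_one hn]; linarith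
    have hmem : ∀ s ∈ Icc s₀ 1, dilate s q ∈ region ε δ := fun s hs => by
      have hpos : 0 < s := hs0.trans_le hs.1
      refine ⟨?_, ?_, hq.2.2.dilate hpos hs.2⟩
      · simp only [dilate]
        rw [mul_left_comm]
        exact mul_pos (by positivity) hq.1
      · simp only [dilate]
        rw [mul_left_comm]
        exact mul_pos hpos hq.2.1
    have hpath : IsPathConnected ((fun s => dilate s q) '' Icc s₀ 1) :=
      ((convex_Icc s₀ 1).isPathConnected ⟨1, hs1, le_rfl⟩).image
        (by unfold dilate; fun_prop)
    have hj1 := (hpath.joinedIn _ ⟨s₀, left_mem_Icc.2 hs1, rfl⟩ _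
      ⟨1, right_mem_Icc.2 hs1, rfl⟩).mono (by rintro _ ⟨s, hs, rfl⟩; exact hmem s hs)
    have hmem0 := hmem s₀ (left_mem_Icc.2 hs1)
    have hsmall : ‖dilate s₀ q‖ < 1 := by
      refine lt_of_le_of_lt (norm_triple_le_iff.2 ?_) hs
      obtain ⟨hx, hy, hz⟩ := norm_triple_le_iff.1 (le_refl ‖q‖)
      have hsq : |s₀ ^ 2| ≤ s₀ := by rw [abs_of_nonneg (by positivity)]; nlinarith
      simp only [dilate, abs_mul]
      refine ⟨mul_le_mul hsq hx (abs_nonneg _) hs0.le, mul_le_mul hsq hy (abs_nonneg _) hs0.le, ?_⟩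
      rw [abs_of_pos hs0]
      exact mul_le_mul_of_nonneg_left hz hs0.le
    have hj2 := (hpc.joinedIn _ hne _ ⟨hmem0.1, hmem0.2.1, hsmall⟩).mono hsub
    have hone : dilate 1 q = q := by simp [dilate]
    exact hj2.trans (by simpa only [hone] using hj1)
  exact ⟨_, hsub hne, fun {q} hq => hjoin q hq⟩

/-! ### Linear coordinates on `N` and elliptic coordinates -/

/-- The minus sign arises because `X₃ = -∂/∂y` at `q₀`. -/
noncomputable def ofCoords (q : ℝ × ℝ × ℝ) : N :=
  q.1 • ContinuousLinearMap.fst ℝ ℝ (ℝ × ℝ) -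
    q.2.1 • (ContinuousLinearMap.fst ℝ ℝ ℝ).comp (ContinuousLinearMap.snd ℝ ℝ (ℝ × ℝ)) +
    q.2.2 • (ContinuousLinearMap.snd ℝ ℝ ℝ).comp (ContinuousLinearMap.snd ℝ ℝ (ℝ × ℝ))

/-- The coordinates `(h₁, h₃, h₂)` on `N`. -/
noncomputable def coords : N ≃ₜ ℝ × ℝ × ℝ where
  toFun lam := (h₁ lam, h₃ lam, h₂ lam)
  invFun := ofCoords
  left_inv lam := by
    have h : lam (0, -1, 0) = -lam (0, 1, 0) := by rw [← map_neg]; simp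
    have h' : lam (1, 0, 0) = lam (1, 0) := rfl
    ext <;> simp [ofCoords, h₁, h₂, h₃, X₁, X₂, X₃, h, h']
  right_inv q := by
    simp [ofCoords, h₁, h₂, h₃, X₁, X₂, X₃]
  continuous_toFun := by
    unfold h₁ h₂ h₃
    fun_prop
  continuous_invFun := by
    unfold ofCoords
    fun_prop

theorem coords_apply (lam : N) : coords lam = (h₁ lam, h₃ lam, h₂ lam) := rfl

theorem radius_coords (lam : N) : radius (coords lam) = rad lam := rfl

theorem totalEnergy_coords (lam : N) : totalEnergy (coords lam) = energy lam := by
  rw [energy, totalEnergy, coords_apply, h₁_eq, vel]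
  ring

/-- Replacing `b` by `b + 2π` changes the signs of both `A` and `B`, which the right-hand side does
not see. The choice of representative of `β` thus disappears from the coordinate relations. -/
theorem exists_half_beta_iff {lam : N} (hr : 0 < rad lam) {A B : ℝ} (hAB : A ^ 2 + B ^ 2 = 1) :
    (∃ b : ℝ, (b : Real.Angle) = beta lam ∧ Real.sin (b / 2) = A ∧ Real.cos (b / 2) = B) ↔
      h₁ lam = -rad lam * (1 - 2 * A ^ 2) ∧ h₃ lam = -(2 * rad lam) * A * B := by
  constructor
  · rintro ⟨b, hb, rfl, rfl⟩
    rw [h₁_eq, h₃_eq, ← hb, Real.Angle.cos_coe, Real.Angle.sin_coe]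
    have hb2 : b = 2 * (b / 2) := by ring
    constructor
    · nth_rw 1 [hb2]
      rw [Real.cos_two_mul]
      linear_combination (-2 * rad lam) * hAB
    · nth_rw 1 [hb2]
      rw [Real.sin_two_mul]
      ring
  · rintro ⟨h1, h3⟩
    obtain ⟨ψ, hc, hs⟩ := exists_cos_sin_eq (x := B) (y := A) (by linarith)
    refine ⟨2 * ψ, ?_, by rw [mul_div_cancel_left₀ _ two_ne_zero, hs],
      by rw [mul_div_cancel_left₀ _ two_ne_zero, hc]⟩
    rw [h₁_eq] at h1
    rw [h₃_eq] at h3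
    simp only [beta, Real.Angle.cos_coe, Real.Angle.sin_coe] at h1 h3
    refine Real.Angle.cos_sin_inj ?_ ?_
    · rw [Real.cos_two_mul, hc]
      refine mul_left_cancel₀ hr.ne' ?_
      linear_combination (2 * rad lam) * hAB + h1
    · rw [Real.sin_two_mul, hc, hs]
      refine mul_left_cancel₀ hr.ne' ?_
      linear_combination h3

/-- The initial phase is `√r φ = τ - p`, since `τ = √r (φ + 1/2)` and `p = √r / 2`. -/
theorem hasCoords₁_iff {lam : N} {τ p k : ℝ} : HasCoords₁ lam τ p k ↔
    0 < p ∧ k ∈ Ioo (0 : ℝ) 1 ∧ coords lam = oscState k p (τ - p) := by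
  constructor
  · rintro ⟨φ, r, ⟨hN, rfl, hk0, hk1, b, hb, hs, hc, hv⟩, rfl, rfl⟩
    have hr : 0 < rad lam := lt_of_le_of_ne (Real.sqrt_nonneg _) hN.1.symm
    have hrt : 0 < √(rad lam) := Real.sqrt_pos.2 hr
    have hrtsq : √(rad lam) ^ 2 = rad lam := Real.sq_sqrt hr.le
    refine ⟨by positivity, ⟨hk0, hk1⟩, ?_⟩
    rw [show √(rad lam) * (φ + 1 / 2) - √(rad lam) / 2 = √(rad lam) * φ by ring]
    obtain ⟨h1, h3⟩ := (exists_half_beta_iff hr (Real.sin_sq_add_cos_sq (b / 2))).1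
      ⟨b, hb, rfl, rfl⟩
    rw [hs] at h1 h3
    rw [hc] at h3
    rw [vel] at hv
    refine Prod.ext ?_ (Prod.ext ?_ ?_)
    · simp only [oscState, coords_apply]
      rw [h1, div_pow, hrtsq]
      ring
    · simp only [oscState, coords_apply]
      rw [h3, div_pow, hrtsq]
      ring
    · simp only [oscState, coords_apply]
      linear_combination 2 * hv
  · rintro ⟨hp, hk, h⟩
    have hr : rad lam = 4 * p ^ 2 := by rw [← radius_coords, h, radius_oscState hk]
    have hE : energy lam = 8 * k ^ 2 * p ^ 2 - 4 * p ^ 2 := by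
      rw [← totalEnergy_coords, h, totalEnergy_oscState]
    have hrt : √(rad lam) = 2 * p := by
      rw [hr, show 4 * p ^ 2 = (2 * p) ^ 2 by ring, Real.sqrt_sq (by positivity)]
    have hk0 := hk.1
    have hk2 : k ^ 2 < 1 := by nlinarith [hk.1, hk.2]
    have hkp : 0 < k ^ 2 * p ^ 2 := by positivity
    have hp2 : 0 < p ^ 2 := by positivity
    have hφ : 2 * p * ((τ - p) / (2 * p)) = τ - p := by field_simp
    refine ⟨(τ - p) / (2 * p), rad lam, ⟨⟨by rw [hr]; positivity, ?_, ?_⟩, rfl, hk.1, hk.2, ?_⟩,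
      by rw [hrt]; ring, by rw [hrt, mul_add, hφ]; ring⟩
    · rw [hr, hE]; linarith
    · rw [hr, hE]; nlinarith
    rw [hrt, hφ]
    have h1 := congrArg Prod.fst h
    have h3 := congrArg (fun q => q.2.1) h
    have h2 := congrArg (fun q => q.2.2) h
    simp only [coords_apply, oscState] at h1 h2 h3
    obtain ⟨b, hb, hs, hc⟩ := (exists_half_beta_iff (lam := lam) (by rw [hr]; positivity)
      (A := k * sn (τ - p) k) (B := dn (τ - p) k) (by rw [dn_sq hk]; ring)).2
      ⟨by rw [h1, hr]; ring, by rw [h3, hr]; ring⟩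
    exact ⟨b, hb, hs, hc, by rw [vel, h2]; ring⟩

theorem signType_coe_sq {s : SignType} (hs : s = 1 ∨ s = -1) : (s : ℝ) ^ 2 = 1 := by
  rcases hs with rfl | rfl <;> simp

theorem sign_eq_of_eq_mul {s : SignType} (hs : s = 1 ∨ s = -1) {v a : ℝ} (ha : 0 < a)
    (h : v = s * a) : SignType.sign v = s := by
  rcases hs with rfl | rfl
  · simp [h, sign_pos ha]
  · simp [h, Left.sign_neg, sign_pos ha]

theorem hasCoords₂_iff {s : SignType} (hs : s = 1 ∨ s = -1) {lam : N} {τ p k : ℝ} :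
    HasCoords₂ s lam τ p k ↔
      0 < p ∧ k ∈ Ioo (0 : ℝ) 1 ∧ coords lam = rotState s k p (τ - p) := by
  have hs2 := signType_coe_sq hs
  constructor
  · rintro ⟨φ, r, ⟨hN, rfl, hk0, hk1, b, hb, hsn, hc, hv⟩, rfl, rfl⟩
    have hr : 0 < rad lam := lt_of_le_of_ne (Real.sqrt_nonneg _) hN.1.1.symm
    have hrt : 0 < √(rad lam) := Real.sqrt_pos.2 hr
    have hrtsq : √(rad lam) ^ 2 = rad lam := Real.sq_sqrt hr.le
    refine ⟨by positivity, ⟨hk0, hk1⟩, ?_⟩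
    rw [show √(rad lam) / k * (φ + 1 / 2) - √(rad lam) / (2 * k) = √(rad lam) * φ / k by
      field_simp; ring]
    obtain ⟨h1, h3⟩ := (exists_half_beta_iff hr (Real.sin_sq_add_cos_sq (b / 2))).1
      ⟨b, hb, rfl, rfl⟩
    rw [hsn] at h1 h3
    rw [hc] at h3
    rw [vel] at hv
    have hkp : 4 * k ^ 2 * (√(rad lam) / (2 * k)) ^ 2 = rad lam := by
      rw [div_pow, hrtsq]; field_simp; ring
    refine Prod.ext ?_ (Prod.ext ?_ ?_)
    · simp only [rotState, coords_apply]
      rw [hkp, h1, mul_pow, hs2, one_mul]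
    · simp only [rotState, coords_apply]
      rw [show 8 * k ^ 2 * (√(rad lam) / (2 * k)) ^ 2 = 2 * rad lam by linear_combination 2 * hkp,
        h3]
      ring
    · simp only [rotState, coords_apply]
      rw [show 4 * (s : ℝ) * (√(rad lam) / (2 * k)) = 2 * (s * (√(rad lam) / k)) by
        field_simp; ring]
      linear_combination 2 * hv
  · rintro ⟨hp, hk, h⟩
    have hr : rad lam = 4 * k ^ 2 * p ^ 2 := by rw [← radius_coords, h, radius_rotState hs2]
    have hE : energy lam = 8 * p ^ 2 - 4 * k ^ 2 * p ^ 2 := by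
      rw [← totalEnergy_coords, h, totalEnergy_rotState hk hs2]
    have hk0 := hk.1
    have hrt : √(rad lam) = 2 * k * p := by
      rw [hr, show 4 * k ^ 2 * p ^ 2 = (2 * k * p) ^ 2 by ring, Real.sqrt_sq (by positivity)]
    have hk2 : k ^ 2 < 1 := by nlinarith [hk.1, hk.2]
    have hp2 : 0 < p ^ 2 := by positivity
    have h1 := congrArg Prod.fst h
    have h3 := congrArg (fun q => q.2.1) h
    have h2 := congrArg (fun q => q.2.2) h
    simp only [coords_apply, rotState] at h1 h2 h3
    have hφ : 2 * k * p * ((τ - p) / (2 * p)) / k = τ - p := by field_simp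
    have hd := dn_pos hk (τ - p)
    refine ⟨(τ - p) / (2 * p), rad lam,
      ⟨⟨⟨by rw [hr]; positivity, ?_⟩, ?_⟩, rfl, hk.1, hk.2, ?_⟩,
      by rw [hrt]; field_simp, by rw [hrt]; field_simp; ring⟩
    · rw [hr, hE]; nlinarith
    · exact sign_eq_of_eq_mul hs (a := 4 * p * dn (τ - p) k) (by positivity)
        (by rw [vel, h2]; ring)
    rw [hrt, hφ]
    obtain ⟨b, hb, hsn, hc⟩ := (exists_half_beta_iff (lam := lam) (by rw [hr]; positivity)
      (A := s * sn (τ - p) k) (B := cn (τ - p) k)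
      (by rw [mul_pow, hs2, one_mul, sn_sq_add_cn_sq])).2
      ⟨by rw [h1, hr, mul_pow, hs2, one_mul], by rw [h3, hr]; ring⟩
    exact ⟨b, hb, hsn, hc, by rw [vel, h2]; field_simp; ring⟩

theorem hasCoords₃_iff {s : SignType} (hs : s = 1 ∨ s = -1) {lam : N} {τ p : ℝ} :
    HasCoords₃ s lam τ p ↔ 0 < p ∧ coords lam = sepState s p (τ - p) := by
  have hs2 := signType_coe_sq hs
  constructor
  · rintro ⟨φ, r, ⟨hN, rfl, b, hb, hsn, hc, hv⟩, rfl, rfl⟩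
    have hr : 0 < rad lam := lt_of_le_of_ne (Real.sqrt_nonneg _) hN.1.1.symm
    have hrt : 0 < √(rad lam) := Real.sqrt_pos.2 hr
    have hrtsq : √(rad lam) ^ 2 = rad lam := Real.sq_sqrt hr.le
    refine ⟨by positivity, ?_⟩
    rw [show √(rad lam) * (φ + 1 / 2) - √(rad lam) / 2 = √(rad lam) * φ by ring]
    obtain ⟨h1, h3⟩ := (exists_half_beta_iff hr (Real.sin_sq_add_cos_sq (b / 2))).1
      ⟨b, hb, rfl, rfl⟩
    rw [hsn] at h1 h3
    rw [hc] at h3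
    rw [vel] at hv
    refine Prod.ext ?_ (Prod.ext ?_ ?_)
    · simp only [sepState, coords_apply]
      rw [h1, div_pow, hrtsq, mul_pow, hs2]
      ring
    · simp only [sepState, coords_apply]
      rw [h3, div_pow, hrtsq]
      ring
    · simp only [sepState, coords_apply]
      linear_combination 2 * hv
  · rintro ⟨hp, h⟩
    have hr : rad lam = 4 * p ^ 2 := by rw [← radius_coords, h, radius_sepState hs2]
    have hE : energy lam = 4 * p ^ 2 := by
      rw [← totalEnergy_coords, h, totalEnergy_sepState hs2]
    have hrt : √(rad lam) = 2 * p := by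
      rw [hr, show 4 * p ^ 2 = (2 * p) ^ 2 by ring, Real.sqrt_sq (by positivity)]
    have hφ : 2 * p * ((τ - p) / (2 * p)) = τ - p := by field_simp
    have h1 := congrArg Prod.fst h
    have h3 := congrArg (fun q => q.2.1) h
    have h2 := congrArg (fun q => q.2.2) h
    simp only [coords_apply, sepState] at h1 h2 h3
    have hch := Real.cosh_pos (τ - p)
    have hp2 : 0 < p ^ 2 := by positivity
    have ht := tanh_sq_add (τ - p)
    refine ⟨(τ - p) / (2 * p), rad lam,
      ⟨⟨⟨by rw [hr]; positivity, by rw [hr, hE], fun hβ => ?_⟩, ?_⟩, rfl, ?_⟩,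
      by rw [hrt]; ring, by rw [hrt, mul_add, hφ]; ring⟩
    · have h1' := h₁_eq lam
      rw [hβ, Real.Angle.cos_coe, Real.cos_pi, h1, hr] at h1'
      have : 0 < (1 / Real.cosh (τ - p)) ^ 2 := by positivity
      nlinarith
    · exact sign_eq_of_eq_mul hs (a := 4 * p * (1 / Real.cosh (τ - p))) (by positivity)
        (by rw [vel, h2]; ring)
    rw [hrt, hφ]
    obtain ⟨b, hb, hsn, hc⟩ := (exists_half_beta_iff (lam := lam) (by rw [hr]; positivity)
      (A := s * Real.tanh (τ - p)) (B := 1 / Real.cosh (τ - p))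
      (by rw [mul_pow, hs2, one_mul, ht])).2
      ⟨by rw [h1, hr, mul_pow, hs2, one_mul], by rw [h3, hr]; ring⟩
    exact ⟨b, hb, hsn, hc, by rw [vel, h2]; ring⟩

/-! ### Quadrants -/

/-- The interval `(α, β)` parametrizes the arc of the unit circle with prescribed signs of the
sine and the cosine. -/
def IsQuadrant (σ χ α β : ℝ) : Prop :=
  (∀ ψ ∈ Ioo α β, 0 < σ * Real.sin ψ ∧ 0 < χ * Real.cos ψ) ∧
    ∀ A C : ℝ, C ^ 2 + A ^ 2 = 1 → 0 < σ * A → 0 < χ * C →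
      ∃ ψ ∈ Ioo α β, Real.sin ψ = A ∧ Real.cos ψ = C

theorem isQuadrant_fourth : IsQuadrant (-1) 1 (-(Real.pi / 2)) 0 := by
  refine ⟨fun ψ hψ => ⟨?_, ?_⟩, fun A C h hA hC => ⟨Real.arcsin A, ⟨?_, ?_⟩, ?_, ?_⟩⟩
  · linarith [Real.sin_neg_of_neg_of_neg_pi_lt hψ.2 (by linarith [hψ.1, Real.pi_pos])]
  · linarith [Real.cos_pos_of_mem_Ioo ⟨hψ.1, by linarith [hψ.2, Real.pi_pos]⟩]
  · exact Real.neg_pi_div_two_lt_arcsin.2 (by nlinarith)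
  · exact Real.arcsin_lt_zero.2 (by linarith)
  · exact Real.sin_arcsin (by nlinarith) (by linarith)
  · rw [Real.cos_arcsin, show 1 - A ^ 2 = C ^ 2 by linarith, Real.sqrt_sq (by linarith)]

/-- A quarter turn replaces `(sin, cos)` by `(cos, -sin)`, so the other quadrants follow from the
fourth. -/
theorem IsQuadrant.rotate {σ χ α β : ℝ} (h : IsQuadrant σ χ α β) :
    IsQuadrant χ (-σ) (α + Real.pi / 2) (β + Real.pi / 2) := by
  refine ⟨fun ψ hψ => ?_, fun A C hAC hA hC => ?_⟩
  · have := h.1 (ψ - Real.pi / 2) ⟨by linarith [hψ.1], by linarith [hψ.2]⟩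
    rw [Real.sin_sub_pi_div_two, Real.cos_sub_pi_div_two] at this
    exact ⟨this.2, by linarith [this.1]⟩
  · obtain ⟨ψ, hψ, hs, hc⟩ := h.2 (-C) A (by linarith) (by linarith) hA
    refine ⟨ψ + Real.pi / 2, ⟨by linarith [hψ.1], by linarith [hψ.2]⟩, ?_, ?_⟩
    · rw [Real.sin_add_pi_div_two, hc]
    · rw [Real.cos_add_pi_div_two, hs, neg_neg]

/-- The counterpart of `IsQuadrant` for `sn` and `cn`, in units of the quarter period. -/
def IsEllipticQuadrant (σ χ a b : ℝ) : Prop :=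
  ∀ k ∈ Ioo (0 : ℝ) 1,
    (∀ u ∈ Ioo (a * ellK k) (b * ellK k), 0 < σ * sn u k ∧ 0 < χ * cn u k) ∧
      ∀ A C : ℝ, C ^ 2 + A ^ 2 = 1 → 0 < σ * A → 0 < χ * C →
        ∃ u ∈ Ioo (a * ellK k) (b * ellK k), sn u k = A ∧ cn u k = C

theorem IsQuadrant.elliptic {σ χ α β a b : ℝ} (h : IsQuadrant σ χ α β)
    (ha : ∀ k ∈ Ioo (0 : ℝ) 1, ellF α k = a * ellK k)
    (hb : ∀ k ∈ Ioo (0 : ℝ) 1, ellF β k = b * ellK k) : IsEllipticQuadrant σ χ a b := by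
  intro k hk
  rw [← ha k hk, ← hb k hk]
  refine ⟨fun u hu => h.1 _ ⟨(lt_am_iff hk).2 hu.1, (am_lt_iff hk).2 hu.2⟩,
    fun A C hAC hA hC => ?_⟩
  obtain ⟨ψ, hψ, hs, hc⟩ := h.2 A C hAC hA hC
  exact ⟨ellF ψ k, ⟨strictMono_ellF hk hψ.1, strictMono_ellF hk hψ.2⟩,
    by rw [sn, am_ellF hk, hs], by rw [cn, am_ellF hk, hc]⟩

theorem isEllipticQuadrant_neg_one_zero : IsEllipticQuadrant (-1) 1 (-1) 0 :=
  isQuadrant_fourth.elliptic (fun k hk => by rw [ellF_neg hk, ellK]; ring)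
    (fun _ _ => by simp)

theorem isQuadrant_first : IsQuadrant 1 1 0 (Real.pi / 2) := by
  simpa using isQuadrant_fourth.rotate

theorem isQuadrant_second : IsQuadrant 1 (-1) (Real.pi / 2) Real.pi := by
  simpa using isQuadrant_first.rotate

theorem isQuadrant_third : IsQuadrant (-1) (-1) Real.pi (3 * Real.pi / 2) := by
  convert isQuadrant_second.rotate using 1 <;> ring

theorem isEllipticQuadrant_zero_one : IsEllipticQuadrant 1 1 0 1 :=
  isQuadrant_first.elliptic (fun _ _ => by simp) (fun _ _ => by rw [ellK, one_mul])

theorem isEllipticQuadrant_one_two : IsEllipticQuadrant 1 (-1) 1 2 :=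
  isQuadrant_second.elliptic (fun _ _ => by rw [ellK, one_mul]) (fun k hk => ellF_pi hk)

theorem isEllipticQuadrant_two_three : IsEllipticQuadrant (-1) (-1) 2 3 :=
  isQuadrant_third.elliptic (fun _ hk => ellF_pi hk) (fun _ hk => ellF_three_pi_div_two hk)

theorem isEllipticQuadrant_three_four : IsEllipticQuadrant (-1) 1 3 4 := by
  have h := isQuadrant_third.rotate
  rw [neg_neg] at h
  refine h.elliptic (fun k hk => ?_) (fun k hk => ?_)
  · rw [← ellF_three_pi_div_two hk]; congr 1; ring
  · rw [← ellF_two_pi hk]; congr 1; ring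

/-! ### The domains as preimages of regions -/

/-- The phase advances by `2p · (1/2) = p` in time `1/2`, which turns `τ - p` into `τ`. -/
theorem mem_block₁_iff {lam : N} {a b : ℝ} : lam ∈ block₁ a b ↔
    ∃ τ p k : ℝ, flow (1 / 2) (coords lam) = oscState k p τ ∧
      τ ∈ Ioo (a * ellK k) (b * ellK k) ∧ p ∈ Ioo 0 (p₁ k) ∧ k ∈ Ioo (0 : ℝ) 1 := by
  refine exists_congr fun τ => exists_congr fun p => exists_congr fun k => ?_
  rw [hasCoords₁_iff]
  constructor
  · rintro ⟨⟨-, -, h⟩, hτ, hp, hk⟩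
    exact ⟨by rw [h, flow_oscState hk]; congr 1; ring, hτ, hp, hk⟩
  · rintro ⟨h, hτ, hp, hk⟩
    refine ⟨⟨hp.1, hk, ?_⟩, hτ, hp, hk⟩
    have := congrArg (flow (-(1 / 2))) h
    rw [flow_add, neg_add_cancel, flow_zero, flow_oscState hk] at this
    rw [this]
    congr 1
    ring

theorem mem_block₂_iff {s : SignType} (hs : s = 1 ∨ s = -1) {lam : N} {a b : ℝ} :
    lam ∈ block₂ s a b ↔ ∃ τ p k : ℝ, flow (1 / 2) (coords lam) = rotState s k p τ ∧
      τ ∈ Ioo (a * ellK k) (b * ellK k) ∧ p ∈ Ioo 0 (ellK k) ∧ k ∈ Ioo (0 : ℝ) 1 := by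
  have hs2 := signType_coe_sq hs
  refine exists_congr fun τ => exists_congr fun p => exists_congr fun k => ?_
  rw [hasCoords₂_iff hs]
  constructor
  · rintro ⟨⟨-, -, h⟩, hτ, hp, hk⟩
    exact ⟨by rw [h, flow_rotState hk hs2]; congr 1; ring, hτ, hp, hk⟩
  · rintro ⟨h, hτ, hp, hk⟩
    refine ⟨⟨hp.1, hk, ?_⟩, hτ, hp, hk⟩
    have := congrArg (flow (-(1 / 2))) h
    rw [flow_add, neg_add_cancel, flow_zero, flow_rotState hk hs2] at this
    rw [this]
    congr 1
    ring

theorem mem_block₃_iff {s : SignType} (hs : s = 1 ∨ s = -1) {lam : N} {I : Set ℝ} :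
    lam ∈ block₃ s I ↔ ∃ τ p : ℝ, flow (1 / 2) (coords lam) = sepState s p τ ∧
      τ ∈ I ∧ p ∈ Ioi (0 : ℝ) := by
  have hs2 := signType_coe_sq hs
  refine exists_congr fun τ => exists_congr fun p => ?_
  rw [hasCoords₃_iff hs]
  constructor
  · rintro ⟨⟨-, h⟩, hτ, hp⟩
    exact ⟨by rw [h, flow_sepState hs2]; congr 1; ring, hτ, hp⟩
  · rintro ⟨h, hτ, hp⟩
    refine ⟨⟨hp, ?_⟩, hτ, hp⟩
    have := congrArg (flow (-(1 / 2))) h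
    rw [flow_add, neg_add_cancel, flow_zero, flow_sepState hs2] at this
    rw [this]
    congr 1
    ring

theorem oscState_mem_region_iff {k : ℝ} (hk : k ∈ Ioo (0 : ℝ) 1) {p : ℝ} (hp : 0 < p)
    {ε δ u : ℝ} : oscState k p u ∈ region ε δ ↔
      0 < -ε * sn u k ∧ 0 < δ * cn u k ∧ p < p₁ k := by
  have hd := dn_pos hk u
  have hk0 := hk.1
  refine and_congr ?_ (and_congr ?_ (admissible_oscState_iff hk hp u))
  · rw [oscState, show ε * (-(8 * p ^ 2) * k * sn u k * dn u k) =
      (8 * p ^ 2 * k * dn u k) * (-ε * sn u k) by ring]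
    exact mul_pos_iff_of_pos_left (by positivity)
  · rw [oscState, show δ * (4 * k * p * cn u k) = (4 * k * p) * (δ * cn u k) by ring]
    exact mul_pos_iff_of_pos_left (by positivity)

theorem rotState_mem_region_iff {k : ℝ} (hk : k ∈ Ioo (0 : ℝ) 1) {p : ℝ} (hp : 0 < p)
    {s : ℝ} (hs : s ^ 2 = 1) {ε δ u : ℝ} : rotState s k p u ∈ region ε δ ↔
      0 < -(ε * s) * (sn u k * cn u k) ∧ 0 < δ * s ∧ p < ellK k := by
  have hd := dn_pos hk u
  have hk0 := hk.1
  refine and_congr ?_ (and_congr ?_ (admissible_rotState_iff hk hs hp u))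
  · rw [rotState, show ε * (-(8 * k ^ 2 * p ^ 2) * s * sn u k * cn u k) =
      (8 * k ^ 2 * p ^ 2) * (-(ε * s) * (sn u k * cn u k)) by ring]
    exact mul_pos_iff_of_pos_left (by positivity)
  · rw [rotState, show δ * (4 * s * p * dn u k) = (4 * p * dn u k) * (δ * s) by ring]
    exact mul_pos_iff_of_pos_left (by positivity)

theorem tanh_eq_mul (u : ℝ) : ∃ a > 0, Real.tanh u = a * u := by
  rcases eq_or_ne u 0 with rfl | hu
  · exact ⟨1, one_pos, by simp⟩
  refine ⟨Real.tanh u / u, ?_, by field_simp⟩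
  have hc := Real.cosh_pos u
  rw [Real.tanh_eq_sinh_div_cosh, div_right_comm]
  refine div_pos ?_ hc
  rcases hu.lt_or_gt with h | h
  · exact div_pos_of_neg_of_neg (Real.sinh_neg_iff.2 h) h
  · exact div_pos (Real.sinh_pos_iff.2 h) h

theorem sepState_mem_region_iff {p : ℝ} (hp : 0 < p) {s : ℝ} (hs : s ^ 2 = 1) {ε δ u : ℝ} :
    sepState s p u ∈ region ε δ ↔ 0 < -(ε * s) * u ∧ 0 < δ * s := by
  have hc := Real.cosh_pos u
  obtain ⟨a, ha, hau⟩ := tanh_eq_mul u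
  refine and_congr ?_ ((and_iff_left (admissible_sepState hs p u)).trans ?_)
  · rw [sepState, hau, show ε * (-(8 * p ^ 2) * s * (a * u) * (1 / Real.cosh u)) =
      (8 * p ^ 2 * a * (1 / Real.cosh u)) * (-(ε * s) * u) by ring]
    exact mul_pos_iff_of_pos_left (by positivity)
  · rw [sepState,
      show δ * (4 * s * p * (1 / Real.cosh u)) = (4 * p * (1 / Real.cosh u)) * (δ * s) by ring]
    exact mul_pos_iff_of_pos_left (by positivity)

theorem eq_of_mul_pos {δ s : ℝ} (hδ : δ = 1 ∨ δ = -1) (hs : s = 1 ∨ s = -1) (h : 0 < δ * s) :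
    s = δ := by
  rcases hδ with rfl | rfl <;> rcases hs with rfl | rfl <;> first | rfl | (exfalso; linarith)

/-- At the midpoint, up to positive factors, `(h₃, h₂)` is `(-sn τ, cn τ)` for oscillations, `(-s sn
τ cn τ, s)` for rotations and `(-s τ, s)` on the separatrix. The hypotheses say that each phase
interval realizes exactly the signs `(ε, s)`. -/
theorem union_eq_preimage_region {ε a b a' b' : ℝ} {s : SignType} {I : Set ℝ}
    (hs : s = 1 ∨ s = -1) (hosc : IsEllipticQuadrant (-ε) s a b)
    (hrot : IsEllipticQuadrant (-(ε * s)) 1 a' b') (hsep : ∀ u, u ∈ I ↔ 0 < -(ε * s) * u) :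
    block₁ a b ∪ block₂ s a' b' ∪ block₃ s I =
      (coords.trans (flowHomeomorph (1 / 2))) ⁻¹' region ε s := by
  have hs2 := signType_coe_sq hs
  have hsR : (s : ℝ) = 1 ∨ (s : ℝ) = -1 := by rcases hs with rfl | rfl <;> simp
  have hss : 0 < (s : ℝ) * s := by nlinarith
  ext lam
  rw [mem_union, mem_union, mem_block₁_iff, mem_block₂_iff hs, mem_block₃_iff hs, mem_preimage]
  change _ ↔ flow (1 / 2) (coords lam) ∈ _
  generalize flow (1 / 2) (coords lam) = q
  constructor
  · rintro ((⟨τ, p, k, rfl, hτ, hp, hk⟩ | ⟨τ, p, k, rfl, hτ, hp, hk⟩) | ⟨τ, p, rfl, hτ, hp⟩)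
    · obtain ⟨h1, h2⟩ := (hosc k hk).1 τ hτ
      exact (oscState_mem_region_iff hk hp.1).2 ⟨h1, h2, hp.2⟩
    · obtain ⟨h1, h2⟩ := (hrot k hk).1 τ hτ
      rw [one_mul] at h2
      refine (rotState_mem_region_iff hk hp.1 hs2).2 ⟨?_, hss, hp.2⟩
      rw [← mul_assoc]
      exact mul_pos h1 h2
    · exact (sepState_mem_region_iff hp hs2).2 ⟨(hsep τ).1 hτ, hss⟩
  · intro hq
    have hy : q.2.1 ≠ 0 := fun h => by simpa [h] using hq.1
    have hr := radius_pos hy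
    have hq0 : ¬(q.2.1 = 0 ∧ q.2.2 = 0) := fun h => hy h.1
    rcases lt_trichotomy (totalEnergy q) (radius q) with hE | hE | hE
    · obtain ⟨k, hk, p, hp, A, C, hAC, h⟩ := exists_oscState hr hq0 hE
      obtain ⟨u, hu, hun⟩ := exists_am_eq hk hAC
      have hmem := hq
      rw [← h u hu hun, oscState_mem_region_iff hk hp, hu, hun] at hmem
      -- The arbitrary phase `u` is replaced by one in the required quarter period with the same
      -- `sn` and `cn`, hence the same state.
      obtain ⟨τ, hτ, hsn, hcn⟩ := (hosc k hk).2 A C hAC hmem.1 hmem.2.1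
      exact Or.inl (Or.inl ⟨τ, p, k, (h τ hsn hcn).symm, hτ, ⟨hp, hmem.2.2⟩, hk⟩)
    · obtain ⟨s', hs', p, hp, u, rfl⟩ := exists_sepState hr hq0 hE
      obtain ⟨h1, h2⟩ := (sepState_mem_region_iff hp (sq_eq_one_of hs')).1 hq
      obtain rfl := eq_of_mul_pos hsR hs' h2
      exact Or.inr ⟨u, p, rfl, (hsep u).2 h1, hp⟩
    · obtain ⟨s', hs', k, hk, p, hp, A, B, hAB, hB, h⟩ := exists_rotState hr hE
      obtain ⟨u, hu, hun⟩ := exists_am_eq hk hAB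
      have hmem := hq
      rw [← h u hu hun, rotState_mem_region_iff hk hp (sq_eq_one_of hs'), hu, hun] at hmem
      obtain ⟨h1, h2, h3⟩ := hmem
      obtain rfl := eq_of_mul_pos hsR hs' h2
      rw [← mul_assoc] at h1
      -- The sign of `h₃` fixes only the sign of the product `sn · cn`; the normalization `B ≥ 0`
      -- separates the two factors.
      have hA := pos_of_mul_pos_left h1 hB
      have hB' := (pos_iff_pos_of_mul_pos h1).1 hA
      obtain ⟨τ, hτ, hsn, hcn⟩ := (hrot k hk).2 A B hAB hA (by linarith)
      exact Or.inl (Or.inr ⟨τ, p, k, (h τ hsn hcn).symm, hτ, ⟨hp, h3⟩, hk⟩)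

theorem isOpen_and_isPathConnected_preimage_region {ε δ : ℝ} (hε : ε ^ 2 = 1) (hδ : δ ^ 2 = 1)
    (f : N ≃ₜ ℝ × ℝ × ℝ) : IsOpen (f ⁻¹' region ε δ) ∧ IsPathConnected (f ⁻¹' region ε δ) :=
  ⟨(isOpen_region ε δ).preimage f.continuous,
    f.isPathConnected_preimage.2 (isPathConnected_region hε hδ)⟩

theorem L₁_eq : L₁ = (coords.trans (flowHomeomorph (1 / 2))) ⁻¹' region (-1) (1 : SignType) :=
  union_eq_preimage_region (Or.inl rfl) (by simpa using isEllipticQuadrant_zero_one)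
    (by simpa using isEllipticQuadrant_zero_one) (by simp)

theorem L₂_eq : L₂ = (coords.trans (flowHomeomorph (1 / 2))) ⁻¹' region (-1) (-1 : SignType) :=
  union_eq_preimage_region (Or.inr rfl) (by simpa using isEllipticQuadrant_one_two)
    (by simpa using isEllipticQuadrant_neg_one_zero) (by simp)

theorem L₃_eq : L₃ = (coords.trans (flowHomeomorph (1 / 2))) ⁻¹' region 1 (-1 : SignType) :=
  union_eq_preimage_region (Or.inr rfl) (by simpa using isEllipticQuadrant_two_three)
    (by simpa using isEllipticQuadrant_zero_one) (by simp)

theorem L₄_eq : L₄ = (coords.trans (flowHomeomorph (1 / 2))) ⁻¹' region 1 (1 : SignType) :=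
  union_eq_preimage_region (Or.inl rfl) (by simpa using isEllipticQuadrant_three_four)
    (by simpa using isEllipticQuadrant_neg_one_zero) (by simp)

end Elastica

theorem mainTheorem3 :
    (IsOpen Elastica.L₁ ∧ IsPathConnected Elastica.L₁) ∧
    (IsOpen Elastica.L₂ ∧ IsPathConnected Elastica.L₂) ∧
    (IsOpen Elastica.L₃ ∧ IsPathConnected Elastica.L₃) ∧
    (IsOpen Elastica.L₄ ∧ IsPathConnected Elastica.L₄) := by
  rw [Elastica.L₁_eq, Elastica.L₂_eq, Elastica.L₃_eq, Elastica.L₄_eq]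
  refine ⟨?_, ?_, ?_, ?_⟩ <;>
    exact Elastica.isOpen_and_isPathConnected_preimage_region (by simp) (by simp) _
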